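/- Let $R$ be an associative, unital, non-trivial ring (not necessarily commutative), and let $E(R)$ denote the injective hull of $R$ as a right $R$-module. Here "one-sided" means "left or right"; $R$ is QF (quasi-Frobenius) if it is one-sided Noetherian and one-sided self-injective (each time left or right); $R$ is right dual Kasch if every simple right $R$-module is a homomorphic image of an injective right $R$-module; $R$ is semilocal if $R/\mathrm{Jac}(R)$ is a semisimple ring; and a right $R$-module $M$ is max-projective if for every maximal right ideal $I$ of $R$ every homomorphism $M\to R/I$ factors through the canonical epimorphism $R\to R/I$. The following statements are equivalent: (a) $R$ is a QF ring. (b) $R$ is one-sided Noetherian, $R$ is right dual Kasch, and $E(R)$ is projective. (c) $R$ is one-sided Noetherian, right dual Kasch and semilocal, and $E(R)$ is max-projective. If, moreover, $R$ is commutative, then (a), (b), (c) are also equivalent to: (d) $R$ is perfect and $E(R)$ is max-projective. Here $R$ is perfect (in the sense of Bass) if $R/\mathrm{Jac}(R)$ is semisimple and $\mathrm{Jac}(R)$ is left and right T-nilpotent, i.e. for every sequence $a_1,a_2,\dots$ in $\mathrm{Jac}(R)$ there are $m,n$ with $a_1a_2\cdots a_m=0$ and $a_n\cdots a_2a_1=0$.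 -/

import Mathlib

/-!
Right modules over a ring `R` are modules over the opposite ring `Rᵐᵒᵖ`; in particular `R_R` is
`R` regarded as an `Rᵐᵒᵖ`-module, and right ideals are terms of `Submodule Rᵐᵒᵖ R`.
-/

universe u

namespace DualKasch

section InjectiveHull

variable {S : Type u} [Ring S] {M : Type u} [AddCommGroup M] [Module S M]

/-- `ι : M → E` exhibits `E` as an injective hull of `M`: the module `E` is injective, `ι` is a
monomorphism, and `E` is an essential extension of the image of `M`. -/
structure IsInjectiveHull {E : Type u} [AddCommGroup E] [Module S E] (ι : M →ₗ[S] E) : Prop where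
  injective : Module.Injective S E
  mono : Function.Injective ι
  essential : ∀ K : Submodule S E, K ⊓ LinearMap.range ι = ⊥ → K = ⊥

/-- Every module embeds into an injective module. -/
theorem exists_injective_embedding (S : Type u) [Ring S] (M : Type u) [AddCommGroup M]
    [Module S M] : ∃ (Q : Type u) (_ : AddCommGroup Q) (_ : Module S Q) (j : M →ₗ[S] Q),
      Module.Injective S Q ∧ Function.Injective j := by
  have ei : CategoryTheory.EnoughInjectives (ModuleCat.{u} S) := inferInstance
  obtain ⟨⟨I, inj, f, monof⟩⟩ := ei.1 (ModuleCat.of S M)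
  refine ⟨I, inferInstance, inferInstance, f.hom, ?_, (ModuleCat.mono_iff_injective f).mp monof⟩
  exact Module.injective_module_of_injective_object (inj := inj) S I

/-- Every module has an injective hull. -/
theorem exists_isInjectiveHull (S : Type u) [Ring S] (M : Type u) [AddCommGroup M]
    [Module S M] : ∃ (E : Type u) (_ : AddCommGroup E) (_ : Module S E) (ι : M →ₗ[S] E),
      IsInjectiveHull ι := by
  obtain ⟨Q, _, _, j, hQ, hj⟩ := exists_injective_embedding S M
  set A := LinearMap.range j with hA
  -- a maximal essential extension `N` of `A` inside `Q`
  obtain ⟨N, hAN, hN⟩ := zorn_le_nonempty₀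
    {N : Submodule S Q | A ≤ N ∧ ∀ K ≤ N, K ⊓ A = ⊥ → K = ⊥} (by
      intro c hc hchain y hy
      refine ⟨sSup c, ⟨(hc hy).1.trans (le_sSup hy), ?_⟩, fun z hz => le_sSup hz⟩
      intro K hK hKA
      rw [Submodule.eq_bot_iff]
      intro x hx
      obtain ⟨N, hNc, hxN⟩ := (Submodule.mem_sSup_of_directed ⟨y, hy⟩ hchain.directedOn).1 (hK hx)
      have h1 : Submodule.span S {x} ≤ N := by simpa using hxN
      have h2 : Submodule.span S {x} ⊓ A = ⊥ := by
        rw [← le_bot_iff, ← hKA]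
        exact inf_le_inf_right _ (by simpa using hx)
      simpa using (hc hNc).2 _ h1 h2) A ⟨le_rfl, fun K hK h => by rwa [inf_eq_left.2 hK] at h⟩
  -- a maximal submodule `C` of `Q` meeting `N` trivially
  obtain ⟨C, -, hC⟩ := zorn_le_nonempty₀ {C : Submodule S Q | Disjoint C N} (by
      intro c hc hchain y hy
      refine ⟨sSup c, ?_, fun z hz => le_sSup hz⟩
      change Disjoint _ _
      rw [Submodule.disjoint_def]
      intro x hx hxN
      obtain ⟨D, hDc, hxD⟩ := (Submodule.mem_sSup_of_directed ⟨y, hy⟩ hchain.directedOn).1 hx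
      exact Submodule.disjoint_def.1 (hc hDc) x hxD hxN) ⊥ disjoint_bot_left
  have hCN : Disjoint C N := hC.prop
  have hψ : Function.Injective (C.mkQ ∘ₗ N.subtype) := by
    rw [← LinearMap.ker_eq_bot, Submodule.eq_bot_iff]
    intro x hx
    have hx' : (x : Q) ∈ C := by simpa using hx
    exact Subtype.ext (Submodule.disjoint_def.1 hCN x hx' x.2)
  obtain ⟨φ, hφ⟩ := hQ.out (C.mkQ ∘ₗ N.subtype) hψ N.subtype
  let θ : Q →ₗ[S] Q := φ ∘ₗ C.mkQ
  have hθN : ∀ x ∈ N, θ x = x := fun x hx => hφ ⟨x, hx⟩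
  have hθC : ∀ x ∈ C, θ x = 0 := fun x hx => by
    have : C.mkQ x = 0 := by simpa using hx
    simp [θ, -Submodule.mkQ_apply, this]
  -- the image of `θ` is an essential extension of `A`, hence equals `N`
  have hrange : LinearMap.range θ ≤ N := by
    refine hN.le_of_ge ⟨?_, ?_⟩ ?_
    · exact fun x hx => ⟨x, hθN x (hAN hx)⟩
    · intro K hK hKA
      have hKN : K ⊓ N = ⊥ := hN.prop.2 _ inf_le_right (by
        rw [← le_bot_iff, ← hKA]
        exact inf_le_inf_right _ inf_le_left)
      have hD : K.comap θ ≤ C := hC.le_of_ge (by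
        change Disjoint _ _
        rw [Submodule.disjoint_def]
        intro x hx hxN
        have hxK : x ∈ K := by
          have := Submodule.mem_comap.1 hx
          rwa [hθN x hxN] at this
        have : x ∈ K ⊓ N := ⟨hxK, hxN⟩
        simpa [hKN] using this) (fun x hx => by
          rw [Submodule.mem_comap, hθC x hx]; exact K.zero_mem)
      rw [Submodule.eq_bot_iff]
      intro x hx
      obtain ⟨y, rfl⟩ := hK hx
      exact hθC y (hD hx)
    · exact fun x hx => ⟨x, hθN x hx⟩
  let r : Q →ₗ[S] N := θ.codRestrict N fun x => hrange ⟨x, rfl⟩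
  refine ⟨N, inferInstance, inferInstance, j.codRestrict N fun x => hAN ⟨x, rfl⟩, ⟨⟨?_⟩, ?_, ?_⟩⟩
  · intro X Y _ _ _ _ f hf g
    obtain ⟨h, hh⟩ := hQ.out f hf (N.subtype ∘ₗ g)
    refine ⟨r ∘ₗ h, fun x => Subtype.ext ?_⟩
    have : θ (h (f x)) = g x := by rw [hh x]; exact hθN _ (g x).2
    exact this
  · exact fun x y hxy => hj (congrArg Subtype.val hxy)
  · intro K hK
    have h1 : K.map N.subtype ⊓ A = ⊥ := by
      rw [Submodule.eq_bot_iff]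
      rintro x ⟨⟨y, hy, rfl⟩, ⟨m, hm⟩⟩
      have : y ∈ K ⊓ LinearMap.range (j.codRestrict N fun x => hAN ⟨x, rfl⟩) :=
        ⟨hy, m, Subtype.ext hm⟩
      rw [hK] at this
      simpa using this
    have h2 := hN.prop.2 _ (Submodule.map_subtype_le N K) h1
    rw [Submodule.eq_bot_iff]
    intro y hy
    have h3 : (y : Q) ∈ K.map N.subtype := ⟨y, hy, rfl⟩
    rw [h2] at h3
    exact Subtype.ext (by simpa using h3)

end InjectiveHull

section Rings

variable (R : Type u) [Ring R]

/-- `R` is left Noetherian or right Noetherian. -/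
def IsOneSidedNoetherian : Prop :=
  IsNoetherian R R ∨ IsNoetherian Rᵐᵒᵖ R

/-- `R` is left self-injective or right self-injective. -/
def IsOneSidedSelfInjective : Prop :=
  Module.Injective R R ∨ Module.Injective Rᵐᵒᵖ R

/-- A quasi-Frobenius (QF) ring: a one-sided Noetherian and one-sided self-injective ring. -/
def IsQF : Prop :=
  IsOneSidedNoetherian R ∧ IsOneSidedSelfInjective R

/-- `R` is right dual Kasch: every simple right `R`-module is a homomorphic image of an injective
right `R`-module. -/
def IsRightDualKasch : Prop :=
  ∀ (T : Type u) [AddCommGroup T] [Module Rᵐᵒᵖ T], IsSimpleModule Rᵐᵒᵖ T →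
    ∃ (I : Type u) (_ : AddCommGroup I) (_ : Module Rᵐᵒᵖ I) (f : I →ₗ[Rᵐᵒᵖ] T),
      Module.Injective Rᵐᵒᵖ I ∧ Function.Surjective f

/-- A right `R`-module `M` is max-projective: for every maximal right ideal `I`, every
homomorphism `M → R/I` factors through the canonical epimorphism `R → R/I`. -/
def IsMaxProjective (M : Type u) [AddCommGroup M] [Module Rᵐᵒᵖ M] : Prop :=
  ∀ I : Submodule Rᵐᵒᵖ R, IsCoatom I → ∀ f : M →ₗ[Rᵐᵒᵖ] (R ⧸ I),
    ∃ g : M →ₗ[Rᵐᵒᵖ] R, I.mkQ ∘ₗ g = f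

/-- `R` is semilocal: `R / Jac(R)` is a semisimple ring. -/
def IsSemilocal : Prop :=
  IsSemisimpleRing (R ⧸ Ring.jacobson R)

/-- `R` is left perfect: it is semilocal and its Jacobson radical is left T-nilpotent, i.e. for
every sequence `a 0, a 1, …` in it, some product `a 0 * a 1 * ⋯ * a (n - 1)` vanishes. -/
def IsLeftPerfect : Prop :=
  IsSemilocal R ∧ ∀ a : ℕ → R, (∀ i, a i ∈ Ring.jacobson R) →
    ∃ n : ℕ, ((List.range n).map a).prod = 0

/-- `R` is right perfect: it is semilocal and its Jacobson radical is right T-nilpotent, i.e. for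
every sequence `a 0, a 1, …` in it, some product `a (n - 1) * ⋯ * a 1 * a 0` vanishes. -/
def IsRightPerfect : Prop :=
  IsSemilocal R ∧ ∀ a : ℕ → R, (∀ i, a i ∈ Ring.jacobson R) →
    ∃ n : ℕ, ((List.range n).map a).reverse.prod = 0

/-- `R` is (left and right) perfect in the sense of Bass. -/
def IsPerfect : Prop :=
  IsLeftPerfect R ∧ IsRightPerfect R

end Rings

end DualKasch

/-! The implications back to QF rest on a trace argument. If for every maximal right ideal `I` some
map `E → R` has image not inside `I`, then the images of all maps `E → R` sum to `R`. So `R` is a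
retract of a finite power of `E`, hence right self-injective (`injective_right_of_trace`). Under the
dual Kasch condition, `R ⧸ I` is a quotient of an injective `Q`. A map `R → Q` lifting `R → R ⧸ I`
extends to `E`, and max-projectivity lifts the resulting `E → R ⧸ I` to `R`. In the commutative
perfect case, T-nilpotence and faithfulness of `E` give `E I ≠ E`, so `E` again maps onto `R ⧸ I`.

The forward implications need the left-right symmetry of QF. Left self-injectivity makes finitely
generated right ideals annihilators, identifies the radical `J` with the elements whose left
annihilator is essential, and makes `R ⧸ J` von Neumann regular. With a chain condition on either
side, `R` becomes semiprimary and right Noetherian. A permutation of the simple blocks of `R ⧸ J`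
shows that every simple left module embeds in `R`, so left ideals are annihilators too, and the
double annihilator conditions give right self-injectivity. Then `E ≅ R`, and every simple right
module is a quotient of the injective `R`.

A commutative perfect self-injective ring is Noetherian by Cohen's theorem: primes are maximal, each
`I ⧸ I²` is finite-dimensional by a double annihilator argument, and Nakayama for T-nilpotent ideals
finishes. -/

section Preliminaries

/-- A linear map `g` into an injective module factors through every linear map `f` with
`ker f ≤ ker g`. -/
theorem Module.Injective.exists_comp_eq {S : Type u} [Ring S] {Q X Y : Type u} [AddCommGroup Q]
    [Module S Q] [AddCommGroup X] [Module S X] [AddCommGroup Y] [Module S Y]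
    (hQ : Module.Injective S Q) (f : X →ₗ[S] Y) (g : X →ₗ[S] Q)
    (hfg : ∀ x, f x = 0 → g x = 0) : ∃ h : Y →ₗ[S] Q, ∀ x, h (f x) = g x := by
  have hle : LinearMap.ker f ≤ LinearMap.ker g := fun x hx => hfg x hx
  obtain ⟨h, hh⟩ := hQ.out ((LinearMap.ker f).liftQ f le_rfl)
    (LinearMap.ker_eq_bot.1 (Submodule.ker_liftQ_eq_bot _ _ _ le_rfl))
    ((LinearMap.ker f).liftQ g hle)
  exact ⟨h, fun x => hh (Submodule.Quotient.mk x)⟩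

/-- A retract of an injective module is injective. -/
theorem Module.Injective.of_retract {S : Type u} [Ring S] {Q M : Type u} [AddCommGroup Q]
    [Module S Q] [AddCommGroup M] [Module S M] (hQ : Module.Injective S Q) (i : M →ₗ[S] Q)
    (p : Q →ₗ[S] M) (hip : ∀ x, p (i x) = x) : Module.Injective S M := by
  refine ⟨fun X Y _ _ _ _ f hf g => ?_⟩
  obtain ⟨h, hh⟩ := hQ.out f hf (i ∘ₗ g)
  exact ⟨p ∘ₗ h, fun x => by simp [hh, hip]⟩

/-! ### The right regular module, the Jacobson radical and regular rings -/

variable (R : Type u) [Ring R]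

/-- The right module `R` and the regular module over the opposite ring agree. -/
def rightRegularEquiv : R ≃ₗ[Rᵐᵒᵖ] Rᵐᵒᵖ where
  toFun := MulOpposite.op
  invFun := MulOpposite.unop
  map_add' _ _ := rfl
  map_smul' _ _ := rfl
  left_inv _ := rfl
  right_inv _ := rfl

variable {R}

/-- The right linear map `R → M` sending `1` to `m`. -/
def rightMulMap {M : Type u} [AddCommGroup M] [Module Rᵐᵒᵖ M] (m : M) : R →ₗ[Rᵐᵒᵖ] M :=
  LinearMap.toSpanSingleton Rᵐᵒᵖ M m ∘ₗ (rightRegularEquiv R).toLinearMap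

@[simp] theorem rightMulMap_apply {M : Type u} [AddCommGroup M] [Module Rᵐᵒᵖ M] (m : M) (r : R) :
    rightMulMap m r = MulOpposite.op r • m := rfl

theorem projective_right_regular : Module.Projective Rᵐᵒᵖ R :=
  Module.Projective.of_equiv (rightRegularEquiv R).symm

theorem isNoetherian_right_iff : IsNoetherian Rᵐᵒᵖ R ↔ IsNoetherianRing Rᵐᵒᵖ :=
  ⟨fun _ => isNoetherian_of_linearEquiv (rightRegularEquiv R),
    fun h => by
      have : IsNoetherian Rᵐᵒᵖ Rᵐᵒᵖ := h
      exact isNoetherian_of_linearEquiv (rightRegularEquiv R).symm⟩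

theorem injective_right_iff : Module.Injective Rᵐᵒᵖ R ↔ Module.Injective Rᵐᵒᵖ Rᵐᵒᵖ :=
  ⟨fun h => h.of_retract (rightRegularEquiv R).symm.toLinearMap
      (rightRegularEquiv R).toLinearMap fun _ => rfl,
    fun h => h.of_retract (rightRegularEquiv R).toLinearMap
      (rightRegularEquiv R).symm.toLinearMap fun _ => rfl⟩

theorem isUnit_one_sub_mul_swap {a b : R} (h : IsUnit (1 - a * b)) : IsUnit (1 - b * a) := by
  obtain ⟨u, hu⟩ := h
  have h1 : (1 - a * b) * (↑u⁻¹ : R) = 1 := by rw [← hu]; simp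
  have h2 : (↑u⁻¹ : R) * (1 - a * b) = 1 := by rw [← hu]; simp
  set c : R := ↑u⁻¹
  -- The inverse is suggested by the geometric series `1 + ba + baba + ⋯ = 1 + b(1 + ab + ⋯)a`.
  refine ⟨⟨1 - b * a, 1 + b * c * a, ?_, ?_⟩, rfl⟩
  · calc (1 - b * a) * (1 + b * c * a) = 1 - b * a + b * ((1 - a * b) * c) * a := by noncomm_ring
      _ = 1 := by rw [h1]; noncomm_ring
  · calc (1 + b * c * a) * (1 - b * a) = 1 - b * a + b * (c * (1 - a * b)) * a := by noncomm_ring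
      _ = 1 := by rw [h2]; noncomm_ring

theorem mem_jacobson_iff_exists_left_inverse {x : R} :
    x ∈ Ring.jacobson R ↔ ∀ y, ∃ z, z * (1 - y * x) = 1 := by
  rw [← Ideal.jacobson_bot, Ideal.mem_jacobson_iff]
  refine ⟨fun h y => ?_, fun h y => ?_⟩
  · obtain ⟨z, hz⟩ := h (-y)
    refine ⟨z, ?_⟩
    rw [Ideal.mem_bot, sub_eq_zero] at hz
    calc z * (1 - y * x) = z * -y * x + z := by noncomm_ring
      _ = 1 := hz
  · obtain ⟨z, hz⟩ := h (-y)
    refine ⟨z, ?_⟩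
    rw [Ideal.mem_bot, sub_eq_zero, ← hz]; noncomm_ring

theorem isUnit_one_sub_of_mem_jacobson {x : R} (hx : x ∈ Ring.jacobson R) : IsUnit (1 - x) := by
  obtain ⟨z, hz⟩ := mem_jacobson_iff_exists_left_inverse.1 hx 1
  rw [one_mul] at hz
  have hz' : z = 1 - (-(z * x)) := by rw [← hz]; noncomm_ring
  obtain ⟨w, hw⟩ := mem_jacobson_iff_exists_left_inverse.1
    ((Ring.jacobson R).neg_mem ((Ring.jacobson R).mul_mem_left z hx)) 1
  rw [one_mul, ← hz'] at hw
  have : w = 1 - x := by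
    calc w = w * (z * (1 - x)) := by rw [hz, mul_one]
      _ = 1 - x := by rw [← mul_assoc, hw, one_mul]
  exact ⟨⟨1 - x, z, this ▸ hw, hz⟩, rfl⟩

/-- The right inverse `z` again has the form `1 - x * y'`, so it is right invertible itself and
hence a unit. Swapping factors then moves from `1 - x * y` to `1 - y * x`. -/
theorem mem_jacobson_of_exists_right_inverse {x : R} (h : ∀ y, ∃ z, (1 - x * y) * z = 1) :
    x ∈ Ring.jacobson R := by
  rw [mem_jacobson_iff_exists_left_inverse]
  intro y
  have hu : IsUnit (1 - x * y) := by
    obtain ⟨z, hz⟩ := h y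
    have hz' : 1 - x * (-(y * z)) = z := by rw [← hz]; noncomm_ring
    obtain ⟨w, hw⟩ := h (-(y * z))
    rw [hz'] at hw
    have : w = 1 - x * y := by
      calc w = ((1 - x * y) * z) * w := by rw [hz, one_mul]
        _ = 1 - x * y := by rw [mul_assoc, hw, mul_one]
    exact ⟨⟨1 - x * y, z, hz, this ▸ hw⟩, rfl⟩
  obtain ⟨u, hu⟩ := isUnit_one_sub_mul_swap hu
  exact ⟨(↑u⁻¹ : R), by rw [← hu]; simp⟩

theorem op_mem_jacobson {x : R} (hx : x ∈ Ring.jacobson R) :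
    MulOpposite.op x ∈ Ring.jacobson Rᵐᵒᵖ := by
  rw [mem_jacobson_iff_exists_left_inverse]
  intro y
  obtain ⟨u, hu⟩ := isUnit_one_sub_of_mem_jacobson
    ((Ring.jacobson R).mul_mem_right y.unop hx)
  refine ⟨MulOpposite.op (↑u⁻¹ : R), MulOpposite.unop_injective ?_⟩
  have : (1 - x * y.unop) * (↑u⁻¹ : R) = 1 := by rw [← hu]; simp
  simpa using this

/-- A von Neumann regular left Noetherian ring is semisimple. -/
theorem isSemisimpleRing_of_regular [IsNoetherianRing R] (hreg : ∀ a : R, ∃ b, a * b * a = a) :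
    IsSemisimpleRing R := by
  -- Take `Re` maximal among the idempotent-generated left ideals inside `I`. If `a ∈ I` is not in
  -- `Re`, regularity applied to `a - ae` gives an idempotent `f` with `fe = 0`. Then `e + f - ef`
  -- is an idempotent of `I` generating a left ideal that contains `e`, `f` and `a`.
  have key : ∀ I : Ideal R, ∃ e : R, e * e = e ∧ I = Ideal.span {e} := by
    intro I
    obtain ⟨N, ⟨hNI, e, he, rfl⟩, hmax⟩ := set_has_maximal_iff_noetherian.2
      (inferInstanceAs (IsNoetherian R R))
      {N : Submodule R R | N ≤ I ∧ ∃ e : R, e * e = e ∧ N = Ideal.span {e}}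
      ⟨⊥, bot_le, 0, by simp, by simp [Ideal.span]⟩
    refine ⟨e, he, le_antisymm (fun a ha => ?_) hNI⟩
    by_contra hae
    have heI : e ∈ I := hNI (Ideal.mem_span_singleton_self e)
    obtain ⟨b, hb⟩ := hreg (a - a * e)
    set a' := a - a * e with ha'
    have ha'e : a' * e = 0 := by rw [ha', sub_mul, mul_assoc, he, sub_self]
    have ha'I : a' ∈ I := I.sub_mem ha (I.mul_mem_left a heI)
    set f := b * a' with hf
    have hff : f * f = f := by rw [hf, mul_assoc, ← mul_assoc a', hb]
    have hfe : f * e = 0 := by rw [hf, mul_assoc, ha'e, mul_zero]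
    have hge : (e + f - e * f) * e = e := by
      rw [sub_mul, add_mul, he, hfe, mul_assoc, hfe]; simp
    have hgf : (e + f - e * f) * f = f := by
      rw [sub_mul, add_mul, hff, mul_assoc, hff]; abel
    have heg : e * (e + f - e * f) = e := by
      rw [mul_sub, mul_add, he, ← mul_assoc e e, he]; abel
    have hfg : f * (e + f - e * f) = f := by
      rw [mul_sub, mul_add, hfe, hff, ← mul_assoc f e, hfe]; simp
    refine hmax (Ideal.span {e + f - e * f}) ⟨?_, e + f - e * f, ?_, rfl⟩ ?_
    · rw [Ideal.span_singleton_le_iff_mem]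
      have hfI : f ∈ I := I.mul_mem_left b ha'I
      exact I.sub_mem (I.add_mem heI hfI) (I.mul_mem_left e hfI)
    · rw [mul_sub, mul_add, hge, hgf, ← mul_assoc _ e, hge]
    · refine lt_of_le_of_ne ?_ fun h => hae ?_
      · rw [Ideal.span_singleton_le_iff_mem, Ideal.mem_span_singleton']
        exact ⟨e, heg⟩
      · rw [h]
        have h1 : e ∈ Ideal.span {e + f - e * f} := Ideal.mem_span_singleton'.2 ⟨e, heg⟩
        have h2 : f ∈ Ideal.span {e + f - e * f} := Ideal.mem_span_singleton'.2 ⟨f, hfg⟩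
        have h3 : a = a' * f + a * e := by
          rw [hf, ← mul_assoc, hb, ha']; abel
        rw [h3]
        exact Ideal.add_mem _ (Ideal.mul_mem_left _ _ h2) (Ideal.mul_mem_left _ _ h1)
  refine (isSemisimpleModule_iff R R).2 ⟨fun I => ?_⟩
  obtain ⟨e, he, rfl⟩ := key I
  refine ⟨Ideal.span {1 - e}, ?_, ?_⟩
  · rw [Submodule.disjoint_def]
    rintro x hx hx'
    obtain ⟨r, rfl⟩ := Ideal.mem_span_singleton'.1 hx
    obtain ⟨s, hs⟩ := Ideal.mem_span_singleton'.1 hx'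
    calc r * e = (r * e) * e := by rw [mul_assoc, he]
      _ = 0 := by rw [← hs, mul_assoc, sub_mul, he]; simp
  · rw [codisjoint_iff, Ideal.eq_top_iff_one]
    exact Submodule.mem_sup.2 ⟨e, Ideal.mem_span_singleton_self e, 1 - e,
      Ideal.mem_span_singleton_self _, by abel⟩

end Preliminaries

/-! ### Left and right annihilators -/

section Annihilators

variable {R : Type u} [Ring R]

/-- The left annihilator of a subset. -/
def lAnn (s : Set R) : Ideal R where
  carrier := {x | ∀ y ∈ s, x * y = 0}
  add_mem' ha hb y hy := by rw [add_mul, ha y hy, hb y hy, add_zero]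
  zero_mem' y _ := zero_mul y
  smul_mem' c x hx y hy := by rw [smul_eq_mul, mul_assoc, hx y hy, mul_zero]

/-- The right annihilator of a subset, as a right ideal. -/
def rAnn (s : Set R) : Submodule Rᵐᵒᵖ R where
  carrier := {y | ∀ x ∈ s, x * y = 0}
  add_mem' ha hb x hx := by rw [mul_add, ha x hx, hb x hx, add_zero]
  zero_mem' x _ := mul_zero x
  smul_mem' c y hy x hx := by
    rw [← MulOpposite.op_unop c, op_smul_eq_mul, ← mul_assoc, hy x hx, zero_mul]

theorem mem_lAnn {s : Set R} {x : R} : x ∈ lAnn s ↔ ∀ y ∈ s, x * y = 0 := Iff.rfl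

theorem mem_lAnn_singleton {x y : R} : x ∈ lAnn {y} ↔ x * y = 0 := by simp [mem_lAnn]

theorem lAnn_anti {s t : Set R} (h : s ⊆ t) : lAnn t ≤ lAnn s := fun _ hx y hy => hx y (h hy)

theorem rAnn_anti {s t : Set R} (h : s ⊆ t) : rAnn t ≤ rAnn s := fun _ hx y hy => hx y (h hy)

theorem subset_rAnn_lAnn (s : Set R) : s ⊆ rAnn (lAnn s : Set R) := fun _ hy _ hx => hx _ hy

theorem subset_lAnn_rAnn (s : Set R) : s ⊆ lAnn (rAnn s : Set R) := fun _ hx _ hy => hy _ hx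

theorem lAnn_span (s : Set R) : lAnn (Submodule.span Rᵐᵒᵖ s : Set R) = lAnn s := by
  refine le_antisymm (lAnn_anti Submodule.subset_span) fun x hx => ?_
  have : Submodule.span Rᵐᵒᵖ s ≤ rAnn {x} :=
    Submodule.span_le.2 fun y hy z hz => by rw [Set.mem_singleton_iff.1 hz]; exact hx y hy
  exact fun y hy => this hy x rfl

theorem lAnn_sup (K L : Submodule Rᵐᵒᵖ R) :
    lAnn ((K ⊔ L : Submodule Rᵐᵒᵖ R) : Set R) = lAnn (K : Set R) ⊓ lAnn (L : Set R) := by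
  refine le_antisymm (le_inf (lAnn_anti (SetLike.coe_subset_coe.2 le_sup_left))
    (lAnn_anti (SetLike.coe_subset_coe.2 le_sup_right))) fun x hx y hy => ?_
  obtain ⟨k, hk, l, hl, rfl⟩ := Submodule.mem_sup.1 hy
  rw [mul_add, hx.1 k hk, hx.2 l hl, add_zero]

theorem rAnn_sup (A B : Ideal R) :
    rAnn ((A ⊔ B : Ideal R) : Set R) = rAnn (A : Set R) ⊓ rAnn (B : Set R) := by
  refine le_antisymm (le_inf (rAnn_anti (SetLike.coe_subset_coe.2 le_sup_left))
    (rAnn_anti (SetLike.coe_subset_coe.2 le_sup_right))) fun x hx y hy => ?_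
  obtain ⟨k, hk, l, hl, rfl⟩ := Submodule.mem_sup.1 hy
  rw [add_mul, hx.1 k hk, hx.2 l hl, add_zero]

/-- A two-sided ideal as a right ideal. -/
def Ideal.toRight (A : Ideal R) [A.IsTwoSided] : Submodule Rᵐᵒᵖ R where
  carrier := A
  add_mem' := A.add_mem
  zero_mem' := A.zero_mem
  smul_mem' c _ hx := A.mul_mem_right c.unop hx

@[simp] theorem Ideal.coe_toRight (A : Ideal R) [A.IsTwoSided] : (A.toRight : Set R) = A := rfl

theorem Ideal.mem_toRight {A : Ideal R} [A.IsTwoSided] {x : R} : x ∈ A.toRight ↔ x ∈ A := Iff.rfl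

instance (A : Ideal R) : (lAnn (A : Set R)).IsTwoSided :=
  ⟨fun b hx y hy => by rw [mul_assoc]; exact hx _ (A.mul_mem_left b hy)⟩

/-- If `m + 1` is the least exponent with `J ^ (m + 1) * x = 0`, any `z ∈ J ^ m` with `z * x ≠ 0`
works. -/
theorem exists_mul_eq_zero_of_isNilpotent_ideal {J : Ideal R} [J.IsTwoSided] (hJ : IsNilpotent J)
    {x : R} (hx : x ≠ 0) : ∃ z, z * x ≠ 0 ∧ ∀ a ∈ J, a * (z * x) = 0 := by
  classical
  have hex : ∃ n, ∀ a ∈ J ^ n, a * x = 0 := by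
    obtain ⟨n, hn⟩ := hJ
    refine ⟨n, fun a ha => ?_⟩
    rw [hn] at ha
    rw [show a = 0 from ha, zero_mul]
  obtain ⟨m, hm⟩ : ∃ m, Nat.find hex = m + 1 := by
    refine Nat.exists_eq_succ_of_ne_zero fun h0 => hx ?_
    have := Nat.find_spec hex
    rw [h0] at this
    simpa [Submodule.pow_zero, Ideal.one_eq_top] using
      this 1 (by simp [Submodule.pow_zero, Ideal.one_eq_top])
  have hmin := Nat.find_min hex (m := m) (by omega)
  push Not at hmin
  obtain ⟨z, hz, hzx⟩ := hmin
  refine ⟨z, hzx, fun a ha => ?_⟩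
  have := Nat.find_spec hex
  rw [hm, Ideal.IsTwoSided.pow_succ] at this
  rw [← mul_assoc]
  exact this _ (Ideal.mul_mem_mul ha hz)

end Annihilators

/-! ### Left self-injective rings: double annihilators, the radical, chain conditions -/

section LeftSelfInjective

variable {R : Type u} [Ring R] (hR : Module.Injective R R)
include hR

/-- The map `rx ↦ ry` on `Rx` is well defined and extends to an endomorphism of `R`, which is right
multiplication by some `c`. -/
theorem exists_eq_mul_of_injective {x y : R} (h : ∀ r, r * x = 0 → r * y = 0) :
    ∃ c, y = x * c := by
  obtain ⟨f, hf⟩ := hR.exists_comp_eq (LinearMap.toSpanSingleton R R x)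
    (LinearMap.toSpanSingleton R R y) (by simpa using h)
  refine ⟨f 1, ?_⟩
  have h1 := hf 1
  simp only [LinearMap.toSpanSingleton_apply, one_smul] at h1
  rw [← h1, ← smul_eq_mul, ← map_smul, smul_eq_mul, mul_one]

/-- For `c` killed by `A ⊓ B`, the map `a + b ↦ ac` on `A + B` is well defined and extends to right
multiplication by some `t`. Then `A` kills `c - t` and `B` kills `t`. -/
theorem rAnn_inf_le (A B : Ideal R) :
    rAnn ((A ⊓ B : Ideal R) : Set R) ≤ rAnn (A : Set R) ⊔ rAnn (B : Set R) := by
  intro c hc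
  obtain ⟨f, hf⟩ := hR.exists_comp_eq (Y := R)
    (A.subtype ∘ₗ LinearMap.fst R A B + B.subtype ∘ₗ LinearMap.snd R A B)
    (LinearMap.toSpanSingleton R R c ∘ₗ A.subtype ∘ₗ LinearMap.fst R A B) (by
      rintro ⟨a, b⟩ hab
      have hab' : (a : R) + b = 0 := hab
      have : (a : R) ∈ B := by
        rw [eq_neg_of_add_eq_zero_left hab']
        exact B.neg_mem b.2
      exact hc a ⟨a.2, this⟩)
  have hf' : ∀ r, f r = r * f 1 := fun r => by
    rw [← smul_eq_mul, ← map_smul, smul_eq_mul, mul_one]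
  refine Submodule.mem_sup.2 ⟨c - f 1, fun a ha => ?_, f 1, fun b hb => ?_, by abel⟩
  · have := hf (⟨a, ha⟩, 0)
    simp only [LinearMap.add_apply, LinearMap.comp_apply, LinearMap.fst_apply,
      LinearMap.snd_apply, Submodule.subtype_apply, map_zero, add_zero,
      LinearMap.toSpanSingleton_apply, smul_eq_mul] at this
    rw [mul_sub, ← this, ← hf', sub_self]
  · have := hf (0, ⟨b, hb⟩)
    simp only [LinearMap.add_apply, LinearMap.comp_apply, LinearMap.fst_apply,
      LinearMap.snd_apply, Submodule.subtype_apply, map_zero, zero_add] at this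
    rw [← hf', this]

theorem rAnn_lAnn_of_fg {K : Submodule Rᵐᵒᵖ R} (hK : K.FG) : rAnn (lAnn (K : Set R) : Set R) = K := by
  refine le_antisymm ?_ (subset_rAnn_lAnn _)
  induction K, hK using Submodule.fg_induction with
  | singleton x =>
    intro y hy
    rw [lAnn_span] at hy
    obtain ⟨c, rfl⟩ := exists_eq_mul_of_injective hR (x := x) (y := y)
      fun r hr => hy r (mem_lAnn_singleton.2 hr)
    exact Submodule.mem_span_singleton.2 ⟨MulOpposite.op c, rfl⟩
  | sup K L hK hL ihK ihL =>
    rw [lAnn_sup]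
    exact (rAnn_inf_le hR _ _).trans (sup_le_sup ihK ihL)

/-- Elements with essential left annihilator lie in the Jacobson radical of a left self-injective
ring. -/
theorem mem_jacobson_of_essential_lAnn {a : R}
    (ha : ∀ x : R, x ≠ 0 → ∃ r, r * x ≠ 0 ∧ r * x * a = 0) : a ∈ Ring.jacobson R := by
  refine mem_jacobson_of_exists_right_inverse fun y => ?_
  -- If `r = ray` with `r ≠ 0`, essentiality gives `sr ≠ 0` with `sra = 0`, yet `sr = sray = 0`. So
  -- `1 - ay` has zero left annihilator.
  obtain ⟨c, hc⟩ := exists_eq_mul_of_injective hR (x := 1 - a * y) (y := 1) (fun r hr => by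
    by_contra hr1
    rw [mul_one] at hr1
    obtain ⟨s, hs, hsa⟩ := ha r hr1
    apply hs
    calc s * r = s * (r * (1 - a * y)) + s * r * a * y := by noncomm_ring
      _ = 0 := by rw [hr, hsa]; simp)
  exact ⟨c, hc.symm⟩

/-- Let `K` be a left ideal maximal with `K ∩ lAnn {a} = 0`. Right multiplication by `a` is
injective on `K`, and its inverse extends to right multiplication by some `b`. Then `a - aba` is
killed on the left by both `K` and `lAnn {a}`, whose sum is essential. -/
theorem exists_essential_lAnn_sub (a : R) : ∃ b : R,
    ∀ x : R, x ≠ 0 → ∃ r, r * x ≠ 0 ∧ r * x * (a - a * b * a) = 0 := by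
  obtain ⟨K, -, hK⟩ := zorn_le_nonempty₀ {C : Ideal R | Disjoint C (lAnn {a})} (by
      intro c hc hchain y hy
      refine ⟨sSup c, ?_, fun z hz => le_sSup hz⟩
      change Disjoint _ _
      rw [Submodule.disjoint_def]
      intro x hx hxN
      obtain ⟨D, hDc, hxD⟩ := (Submodule.mem_sSup_of_directed ⟨y, hy⟩ hchain.directedOn).1 hx
      exact Submodule.disjoint_def.1 (hc hDc) x hxD hxN) ⊥ disjoint_bot_left
  have hdis : ∀ x ∈ K, x * a = 0 → x = 0 := fun x hx hxa =>
    Submodule.disjoint_def.1 hK.prop x hx (mem_lAnn_singleton.2 hxa)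
  obtain ⟨f, hf⟩ := hR.exists_comp_eq (LinearMap.toSpanSingleton R R a ∘ₗ K.subtype) K.subtype
    (fun x hx => hdis x x.2 hx)
  have hf' : ∀ r, f r = r * f 1 := fun r => by
    rw [← smul_eq_mul, ← map_smul, smul_eq_mul, mul_one]
  have hka : ∀ k ∈ K, k * a * f 1 = k := fun k hk => by rw [← hf']; exact hf ⟨k, hk⟩
  refine ⟨f 1, fun x hx => ?_⟩
  by_contra! hcon
  have hle : K ⊔ Ideal.span {x} ≤ K := by
    refine hK.le_of_ge ?_ le_sup_left
    change Disjoint _ _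
    rw [Submodule.disjoint_def]
    intro y hy hya
    rw [mem_lAnn_singleton] at hya
    obtain ⟨k, hk, z, hz, rfl⟩ := Submodule.mem_sup.1 hy
    obtain ⟨r, rfl⟩ := Ideal.mem_span_singleton'.1 hz
    by_cases hrx : r * x = 0
    · rw [hrx, add_zero] at hya ⊢
      exact hdis k hk hya
    · refine absurd ?_ (hcon r hrx)
      have h1 : r * x * a = -(k * a) := by
        rw [add_mul] at hya
        exact eq_neg_of_add_eq_zero_right hya
      calc r * x * (a - a * f 1 * a) = r * x * a - r * x * a * f 1 * a := by noncomm_ring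
        _ = 0 := by rw [h1, neg_mul, neg_mul, hka k hk, sub_self]
  have hxK : x ∈ K := hle (Submodule.mem_sup_right (Ideal.mem_span_singleton_self x))
  refine hcon 1 (by rwa [one_mul]) ?_
  calc 1 * x * (a - a * f 1 * a) = x * a - x * a * f 1 * a := by noncomm_ring
    _ = 0 := by rw [hka x hxK, sub_self]

/-- Here `a - aba = a(1 - ba)` has essential left annihilator, and `1 - ba` is a unit. -/
theorem essential_lAnn_of_mem_jacobson {a : R} (ha : a ∈ Ring.jacobson R) {x : R} (hx : x ≠ 0) :
    ∃ r, r * x ≠ 0 ∧ r * x * a = 0 := by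
  obtain ⟨b, hb⟩ := exists_essential_lAnn_sub hR a
  obtain ⟨r, hr, hra⟩ := hb x hx
  refine ⟨r, hr, ?_⟩
  obtain ⟨u, hu⟩ := isUnit_one_sub_of_mem_jacobson ((Ring.jacobson R).mul_mem_left b ha)
  have h1 : r * x * a * u = 0 := by
    rw [hu, ← hra]; noncomm_ring
  exact (Units.mul_left_eq_zero u).1 h1

theorem exists_sub_mem_jacobson (a : R) : ∃ b, a - a * b * a ∈ Ring.jacobson R := by
  obtain ⟨b, hb⟩ := exists_essential_lAnn_sub hR a
  exact ⟨b, mem_jacobson_of_essential_lAnn hR hb⟩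

theorem quotient_jacobson_regular (a : R ⧸ Ring.jacobson R) : ∃ b, a * b * a = a := by
  obtain ⟨a, rfl⟩ := Ideal.Quotient.mk_surjective a
  obtain ⟨b, hb⟩ := exists_sub_mem_jacobson hR a
  refine ⟨Ideal.Quotient.mk _ b, ?_⟩
  rw [← map_mul, ← map_mul, eq_comm]
  exact Ideal.Quotient.eq.2 hb

theorem isSemisimpleRing_quotient_jacobson_of_left [IsNoetherianRing R] :
    IsSemisimpleRing (R ⧸ Ring.jacobson R) :=
  have : IsNoetherianRing (R ⧸ Ring.jacobson R) :=
    isNoetherianRing_of_surjective R _ (Ideal.Quotient.mk (Ring.jacobson R))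
      Ideal.Quotient.mk_surjective
  isSemisimpleRing_of_regular (quotient_jacobson_regular hR)

theorem isSemisimpleRing_quotient_jacobson_of_right [IsNoetherianRing Rᵐᵒᵖ] :
    IsSemisimpleRing (R ⧸ Ring.jacobson R) := by
  have : IsNoetherianRing (R ⧸ Ring.jacobson R)ᵐᵒᵖ :=
    isNoetherianRing_of_surjective Rᵐᵒᵖ _ (Ideal.Quotient.mk (Ring.jacobson R)).op fun x => by
      obtain ⟨y, hy⟩ := Ideal.Quotient.mk_surjective x.unop
      exact ⟨MulOpposite.op y, MulOpposite.unop_injective hy⟩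
  rw [← isSemisimpleRing_mulOpposite_iff]
  refine isSemisimpleRing_of_regular fun a => ?_
  obtain ⟨b, hb⟩ := quotient_jacobson_regular hR a.unop
  refine ⟨MulOpposite.op b, MulOpposite.unop_injective ?_⟩
  simpa [mul_assoc] using hb

theorem isNilpotent_jacobson_of_left [IsNoetherianRing R] : IsNilpotent (Ring.jacobson R) := by
  set J := Ring.jacobson R
  have hmono : Monotone fun n => lAnn ((J ^ n : Ideal R) : Set R) :=
    fun m n hmn => lAnn_anti (SetLike.coe_subset_coe.2 (Ideal.pow_le_pow_right hmn))
  obtain ⟨n, hn⟩ := monotone_stabilizes_iff_noetherian.2 (inferInstanceAs (IsNoetherian R R))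
    ⟨_, hmono⟩
  have hn1 : lAnn ((J ^ n : Ideal R) : Set R) = lAnn ((J ^ (n + 1) : Ideal R) : Set R) :=
    hn (n + 1) (Nat.le_succ n)
  refine ⟨n + 1, ?_⟩
  by_contra hne
  have hex : ∃ a ∈ J, a ∉ lAnn ((J ^ n : Ideal R) : Set R) := by
    by_contra! hall
    refine hne (le_bot_iff.1 ?_)
    rw [Ideal.IsTwoSided.pow_succ, Ideal.mul_le]
    exact fun r hr s hs => hall r hr s hs
  -- Choose `a ∈ J` with `a J ^ n ≠ 0` and `lAnn {a}` maximal. For `b ∈ J`, essentiality of `lAnn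
  -- {b}` makes `lAnn {ab}` strictly larger, so `ab J ^ n = 0`. Hence `a J ^ (n + 1) = 0`,
  -- contradicting the choice of `n`.
  obtain ⟨_, ⟨a, haJ, ha, rfl⟩, hmax⟩ := set_has_maximal_iff_noetherian.2
    (inferInstanceAs (IsNoetherian R R))
    {N : Submodule R R | ∃ a ∈ J, a ∉ lAnn ((J ^ n : Ideal R) : Set R) ∧ N = lAnn {a}} (by
      obtain ⟨a, haJ, ha⟩ := hex
      exact ⟨_, a, haJ, ha, rfl⟩)
  have ha0 : a ≠ 0 := fun h => ha (h ▸ Submodule.zero_mem _)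
  refine ha ?_
  rw [hn1, Ideal.IsTwoSided.pow_succ]
  intro y hy
  refine Submodule.mul_induction_on hy (fun b hb c hc => ?_) (fun u v hu hv => by
    rw [mul_add, hu, hv, add_zero])
  obtain ⟨r, hr, hrb⟩ := essential_lAnn_of_mem_jacobson hR hb ha0
  by_contra habc
  refine hmax (lAnn {a * b}) ⟨a * b, J.mul_mem_left a hb, fun h => habc ?_, rfl⟩ ?_
  · rw [← mul_assoc]; exact h c hc
  · refine lt_of_le_of_ne (fun s hs => ?_) fun h => hr ?_
    · rw [mem_lAnn_singleton] at hs ⊢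
      rw [← mul_assoc, hs, zero_mul]
    · rw [← mem_lAnn_singleton, h, mem_lAnn_singleton, ← mul_assoc, hrb]

/-- The left annihilators of the powers of `J` stabilize as right ideals. Taking right annihilators
recovers the powers, so `J ^ n = J ^ (n + 1)`, and Nakayama applies. -/
theorem isNilpotent_jacobson_of_right [IsNoetherianRing Rᵐᵒᵖ] :
    IsNilpotent (Ring.jacobson R) := by
  have hN : IsNoetherian Rᵐᵒᵖ R := isNoetherian_right_iff.2 ‹_›
  set J := Ring.jacobson R
  have hmono : Monotone fun n => (lAnn ((J ^ n : Ideal R) : Set R)).toRight :=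
    fun m n hmn => SetLike.coe_subset_coe.1
      (lAnn_anti (SetLike.coe_subset_coe.2 (Ideal.pow_le_pow_right hmn)))
  obtain ⟨n, hn⟩ := monotone_stabilizes_iff_noetherian.2 hN ⟨_, hmono⟩
  have hn1 : (lAnn ((J ^ n : Ideal R) : Set R) : Set R) = lAnn ((J ^ (n + 1) : Ideal R) : Set R) :=
    congrArg (fun K : Submodule Rᵐᵒᵖ R => (K : Set R)) (hn (n + 1) (Nat.le_succ n))
  have hcl : ∀ m, rAnn (lAnn ((J ^ m : Ideal R) : Set R) : Set R) = (J ^ m).toRight :=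
    fun m => rAnn_lAnn_of_fg hR (K := (J ^ m).toRight) (IsNoetherian.noetherian _)
  have heq : (J ^ n).toRight = (J ^ (n + 1)).toRight := by rw [← hcl, ← hcl, hn1]
  have hbot : (J ^ n).toRight = ⊥ := by
    refine Submodule.FG.eq_bot_of_le_jacobson_smul (IsNoetherian.noetherian _) fun x hx => ?_
    rw [heq, Ideal.mem_toRight, Submodule.pow_succ] at hx
    refine Submodule.mul_induction_on hx (fun b hb c hc => ?_)
      (fun u v hu hv => Submodule.add_mem _ hu hv)
    exact Submodule.smul_mem_smul (op_mem_jacobson hc) (show b ∈ (J ^ n).toRight from hb)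
  refine ⟨n, (Submodule.eq_bot_iff _).2 fun x hx => ?_⟩
  have : x ∈ (J ^ n).toRight := hx
  rw [hbot] at this
  simpa using this

/-- By Hopkins–Levitzki `R` is left Artinian, so a right ideal `K` contains a finite set `s` with
minimal left annihilator. This annihilator kills all of `K`, so `K` lies in the double annihilator
of `sR`, which is `sR`. -/
theorem isNoetherian_right_of_left [IsNoetherianRing R] : IsNoetherianRing Rᵐᵒᵖ := by
  classical
  have hsp : IsSemiprimaryRing R :=
    ⟨isSemisimpleRing_quotient_jacobson_of_left hR, isNilpotent_jacobson_of_left hR⟩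
  have hart : IsArtinian R R := IsSemiprimaryRing.isNoetherian_iff_isArtinian.1
    (inferInstanceAs (IsNoetherian R R))
  refine isNoetherian_right_iff.1 ⟨fun K => ?_⟩
  obtain ⟨_, ⟨s, hs, rfl⟩, hmin⟩ := IsArtinian.set_has_minimal
    {N : Submodule R R | ∃ s : Finset R, (s : Set R) ⊆ K ∧ N = lAnn (s : Set R)}
    ⟨_, ∅, by simp, rfl⟩
  refine ⟨s, le_antisymm (Submodule.span_le.2 hs) fun k hk => ?_⟩
  rw [← rAnn_lAnn_of_fg hR ⟨s, rfl⟩, lAnn_span]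
  intro x hx
  have hle : lAnn ((insert k s : Finset R) : Set R) ≤ lAnn (s : Set R) := lAnn_anti (by simp)
  have := hmin _ ⟨insert k s, by
    rw [Finset.coe_insert]; exact Set.insert_subset hk hs, rfl⟩
  have heq := eq_of_le_of_not_lt hle this
  have hx' : x ∈ lAnn ((insert k s : Finset R) : Set R) := by rw [heq]; exact hx
  exact hx' k (by simp)

end LeftSelfInjective

/-! ### The left Kasch property and the passage to right self-injectivity -/

section Kasch

variable {R : Type u} [Ring R]

/-- In a semilocal ring every maximal left ideal is, modulo the radical, the annihilator of an
element. -/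
theorem exists_mul_mem_jacobson_of_isCoatom [IsSemisimpleRing (R ⧸ Ring.jacobson R)]
    {I : Ideal R} (hI : IsCoatom I) :
    ∃ b, 1 - b ∈ I ∧ b ∉ I ∧ ∀ x ∈ I, x * b ∈ Ring.jacobson R := by
  set J := Ring.jacobson R
  have hJI : J ≤ I := sInf_le hI
  -- The element `b` represents the component of `1` in a complement of `I ⧸ J`.
  obtain ⟨K, hK⟩ := exists_isCompl (I.map (Ideal.Quotient.mk J))
  have h1 : (1 : R ⧸ J) ∈ I.map (Ideal.Quotient.mk J) ⊔ K := by
    rw [hK.sup_eq_top]; trivial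
  obtain ⟨a', ha', b', hb', hab⟩ := Submodule.mem_sup.1 h1
  obtain ⟨a, ha, rfl⟩ := (Ideal.mem_map_iff_of_surjective _ Ideal.Quotient.mk_surjective).1 ha'
  have hb1 : Ideal.Quotient.mk J (1 - a) ∈ K := by
    rw [map_sub, map_one, ← hab, add_sub_cancel_left]; exact hb'
  refine ⟨1 - a, by simpa using ha, fun hb => hI.1 ?_, fun x hx => ?_⟩
  · rw [Ideal.eq_top_iff_one]
    simpa using I.add_mem hb ha
  · have hxI : x * (1 - a) ∈ I := by
      rw [mul_sub, mul_one]; exact I.sub_mem hx (I.mul_mem_left x ha)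
    have := Submodule.disjoint_def.1 hK.disjoint (Ideal.Quotient.mk J (x * (1 - a)))
      (Ideal.mem_map_of_mem _ hxI) (by rw [map_mul]; exact K.mul_mem_left _ hb1)
    exact Ideal.Quotient.eq_zero_iff_mem.1 this

theorem one_mem_of_isSimpleRing {S : Type u} [Ring S] [IsSimpleRing S] (f : R →+* S)
    (hf : Function.Surjective f) (T : Ideal R) [T.IsTwoSided] (hT : ∀ x, f x = 0 → x ∈ T) {b : R}
    (hbT : b ∈ T) (hb : f b ≠ 0) : (1 : R) ∈ T := by
  have : RingHomSurjective f := ⟨hf⟩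
  have hmap : (T.map f).IsTwoSided := inferInstance
  have := ((isSimpleRing_iff_isTwoSided_imp (R := S)).1 inferInstance).2 (T.map f) hmap
  rcases this with h | h
  · exact absurd (by simpa [h] using Ideal.mem_map_of_mem f hbT) hb
  · obtain ⟨t, ht, ht1⟩ := (Ideal.mem_map_iff_of_surjective f hf).1
      (show (1 : S) ∈ T.map f by rw [h]; trivial)
    have : 1 - t ∈ T := hT _ (by rw [map_sub, ht1, map_one, sub_self])
    simpa using T.add_mem this ht

/-- If `x ≠ 0` is killed on the left by the kernel of a map onto a simple ring, then `R b R`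
does not kill `x` unless `b` is in that kernel. -/
theorem exists_mul_mul_ne_zero {S : Type u} [Ring S] [IsSimpleRing S] (f : R →+* S)
    (hf : Function.Surjective f) {x : R} (hx : x ≠ 0) (hfx : ∀ p, f p = 0 → p * x = 0) {b : R}
    (hb : f b ≠ 0) : ∃ u, b * u * x ≠ 0 := by
  by_contra! hcon
  let T : Ideal R :=
    { carrier := {r | ∀ u, r * u * x = 0}
      add_mem' := fun ha hb u => by rw [add_mul, add_mul, ha u, hb u, add_zero]
      zero_mem' := fun u => by simp
      smul_mem' := fun c r hr u => by
        rw [smul_eq_mul, mul_assoc, mul_assoc, ← mul_assoc r, hr u, mul_zero] }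
  have : T.IsTwoSided := ⟨fun c hr u => by rw [mul_assoc _ c]; exact hr (c * u)⟩
  have h1 : (1 : R) ∈ T := one_mem_of_isSimpleRing f hf T
    (fun p hp u => hfx _ (by rw [map_mul, hp, zero_mul])) hcon hb
  exact hx (by simpa using h1 1)

/-- A left self-injective ring with nilpotent radical and a Wedderburn decomposition of its
radical quotient, in which all right ideals are annihilators, is left Kasch. -/
theorem exists_lAnn_ne_of_decomposition (hR : Module.Injective R R)
    (hcl : ∀ K : Submodule Rᵐᵒᵖ R, rAnn (lAnn (K : Set R) : Set R) = K)
    [IsSemisimpleRing (R ⧸ Ring.jacobson R)]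
    (hnil : IsNilpotent (Ring.jacobson R)) {ι : Type} [Finite ι] {S : ι → Type u}
    [∀ i, Ring (S i)] [∀ i, IsSimpleRing (S i)] (f : R →+* ∀ i, S i)
    (hf : Function.Surjective f) (hker : ∀ x, f x = 0 ↔ x ∈ Ring.jacobson R)
    {I : Ideal R} (hI : IsCoatom I) : ∃ x : R, x ≠ 0 ∧ ∀ a ∈ I, a * x = 0 := by
  classical
  have := Fintype.ofFinite ι
  let g : ∀ i, R →+* S i := fun i => (Pi.evalRingHom S i).comp f
  have hg : ∀ i, Function.Surjective (g i) := fun i =>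
    (Function.surjective_eval i).comp hf
  have hJg : ∀ i x, x ∈ Ring.jacobson R → g i x = 0 := fun i x hx =>
    congrFun ((hker x).2 hx) i
  choose c hc using fun i => hf (Pi.single i 1)
  have hci : ∀ i, g i (c i) = 1 := fun i => by simp [g, hc]
  have hcij : ∀ i j, j ≠ i → g j (c i) = 0 := fun i j hij => by simp [g, hc, hij]
  have hPc : ∀ i p, g i p = 0 → p * c i ∈ Ring.jacobson R := fun i p hp => by
    rw [← hker]
    ext j
    by_cases hij : j = i
    · subst hij; change g j (p * c j) = 0; rw [map_mul, hp, zero_mul]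
    · change g j (p * c i) = 0; rw [map_mul, hcij i j hij, mul_zero]
  have hcsum : 1 - ∑ i, c i ∈ Ring.jacobson R := by
    rw [← hker, map_sub, map_one, map_sum, sub_eq_zero]
    simp_rw [hc]
    exact (Finset.univ_sum_single (1 : ∀ i, S i)).symm
  -- With `P i = ker (g i)`, the ideal `P i` is proper and a right annihilator, so some `x ≠ 0` has
  -- `x P i = 0`. Multiplying on the left first makes `J` kill `x`, then the lifted central
  -- idempotents `c j` isolate one block `j`, since `P j * c j ⊆ J`.
  have hstep : ∀ i, ∃ j, ∃ x : R, x ≠ 0 ∧ (∀ p, g i p = 0 → x * p = 0) ∧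
      ∀ p, g j p = 0 → p * x = 0 := by
    intro i
    have h0 : ∃ x : R, x ≠ 0 ∧ ∀ p, g i p = 0 → x * p = 0 := by
      by_contra! hcon
      have hbot : lAnn ((RingHom.ker (g i)).toRight : Set R) = ⊥ := by
        rw [Submodule.eq_bot_iff]
        intro x hx
        by_contra hx0
        obtain ⟨p, hp, hxp⟩ := hcon x hx0
        exact hxp (hx p hp)
      have h1 : (1 : R) ∈ rAnn (lAnn ((RingHom.ker (g i)).toRight : Set R) : Set R) := by
        rw [hbot]
        intro x hx
        rw [show x = 0 from hx, zero_mul]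
      rw [hcl, Ideal.mem_toRight, RingHom.mem_ker, map_one] at h1
      exact one_ne_zero h1
    obtain ⟨x, hx, hxi⟩ := h0
    obtain ⟨z, hzx, hJz⟩ := exists_mul_eq_zero_of_isNilpotent_ideal hnil hx
    have hsum : z * x = ∑ j, c j * (z * x) := by
      have := hJz _ hcsum
      rwa [sub_mul, one_mul, sub_eq_zero, Finset.sum_mul] at this
    obtain ⟨j, -, hj⟩ := Finset.exists_ne_zero_of_sum_ne_zero (hsum ▸ hzx)
    refine ⟨j, c j * (z * x), hj, fun p hp => ?_, fun p hp => ?_⟩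
    · rw [mul_assoc, mul_assoc, hxi p hp, mul_zero, mul_zero]
    · rw [← mul_assoc]; exact hJz _ (hPc j p hp)
  choose π x hx hxr hxl using hstep
  -- If `π i = π i'`, both `x i` and `x i'` have left multiples with annihilator containing the same
  -- maximal `I`, generating isomorphic simple left modules. By injectivity one is a right multiple
  -- of the other. Their right annihilators contain `P i` and `P i'`, which together generate `1`.
  have hπ : Function.Injective π := by
    intro i i' hii'
    by_contra hne
    obtain ⟨I, hI, hPI⟩ := (eq_top_or_exists_le_coatom (RingHom.ker (g (π i)))).resolve_left
      (RingHom.ker_ne_top _)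
    obtain ⟨b, -, hbI, hIb⟩ := exists_mul_mem_jacobson_of_isCoatom hI
    have hb : g (π i) b ≠ 0 := fun h => hbI (hPI h)
    obtain ⟨u, hu⟩ := exists_mul_mul_ne_zero (g (π i)) (hg _) (hx i) (hxl i) hb
    obtain ⟨v, hv⟩ := exists_mul_mul_ne_zero (g (π i)) (hg _) (hx i') (hii' ▸ hxl i') hb
    have hIk : ∀ y, (∀ p, g (π i) p = 0 → p * y = 0) → ∀ w, ∀ a ∈ I, a * (b * w * y) = 0 := by
      intro y hy w a ha
      rw [← mul_assoc, ← mul_assoc]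
      exact hy _ (by rw [map_mul, hJg _ _ (hIb a ha), zero_mul])
    have hle : ∀ r, r * (b * u * x i) = 0 → r * (b * v * x i') = 0 := by
      intro r hr
      have hIl : I ≤ lAnn {b * u * x i} := fun a ha =>
        mem_lAnn_singleton.2 (hIk _ (hxl i) u a ha)
      have heq : lAnn {b * u * x i} = I := by
        rcases hIl.lt_or_eq with h | h
        · refine absurd ?_ hu
          have : (1 : R) ∈ lAnn {b * u * x i} := by rw [hI.2 _ h]; trivial
          simpa using mem_lAnn_singleton.1 this
        · exact h.symm
      exact hIk _ (hii' ▸ hxl i') v r (heq ▸ mem_lAnn_singleton.2 hr)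
    obtain ⟨d, hd⟩ := exists_eq_mul_of_injective hR hle
    have h1 : b * v * x i' * c i = 0 := by
      rw [mul_assoc, hxr i' _ (hcij i i' (Ne.symm hne)), mul_zero]
    have h2 : b * v * x i' * (1 - c i) = 0 := by
      rw [hd, mul_assoc _ d, mul_assoc, hxr i _ (by
        rw [map_mul, map_sub, hci, map_one, sub_self, mul_zero]), mul_zero]
    refine hv ?_
    calc b * v * x i' = b * v * x i' * (1 - c i) + b * v * x i' * c i := by noncomm_ring
      _ = 0 := by rw [h1, h2, add_zero]
  have hsurj : Function.Surjective π := Finite.surjective_of_injective hπ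
  obtain ⟨b, -, hbI, hIb⟩ := exists_mul_mem_jacobson_of_isCoatom hI
  have hbJ : f b ≠ 0 := fun h => hbI ((sInf_le hI : Ring.jacobson R ≤ I) ((hker b).1 h))
  obtain ⟨j, hj⟩ := Function.ne_iff.1 hbJ
  obtain ⟨i, rfl⟩ := hsurj j
  obtain ⟨u, hu⟩ := exists_mul_mul_ne_zero (g (π i)) (hg _) (hx i) (hxl i) hj
  refine ⟨_, hu, fun a ha => ?_⟩
  rw [← mul_assoc, ← mul_assoc]
  exact hxl i _ (by rw [map_mul, hJg _ _ (hIb a ha), zero_mul])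

theorem exists_lAnn_ne (hR : Module.Injective R R) [IsNoetherianRing Rᵐᵒᵖ] {I : Ideal R}
    (hI : IsCoatom I) : ∃ x : R, x ≠ 0 ∧ ∀ a ∈ I, a * x = 0 := by
  have hN : IsNoetherian Rᵐᵒᵖ R := isNoetherian_right_iff.2 ‹_›
  have hss := isSemisimpleRing_quotient_jacobson_of_right hR
  obtain ⟨n, D, d, _, _, ⟨e⟩⟩ :=
    IsSemisimpleRing.exists_ringEquiv_pi_matrix_divisionRing (R ⧸ Ring.jacobson R)
  exact exists_lAnn_ne_of_decomposition hR
    (fun K => rAnn_lAnn_of_fg hR (IsNoetherian.noetherian K))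
    (isNilpotent_jacobson_of_right hR)
    (S := fun i => Matrix (Fin (d i)) (Fin (d i)) (D i))
    (e.toRingHom.comp (Ideal.Quotient.mk _)) (e.surjective.comp Ideal.Quotient.mk_surjective)
    (fun x => by simp [Ideal.Quotient.eq_zero_iff_mem]) hI

/-- For `y ∉ A`, the module `(A + Ry) ⧸ A` has a simple quotient `R ⧸ I`, which maps to `R` by `1 ↦
x ≠ 0`. The map `a + ry ↦ rx` extends to right multiplication by some `t` with `At = 0` and `yt =
x`, so `y` is not in the double annihilator. -/
theorem lAnn_rAnn (hR : Module.Injective R R)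
    (hK : ∀ I : Ideal R, IsCoatom I → ∃ x : R, x ≠ 0 ∧ ∀ a ∈ I, a * x = 0) (A : Ideal R) :
    lAnn (rAnn (A : Set R) : Set R) = A := by
  refine le_antisymm (fun y hy => ?_) (subset_lAnn_rAnn _)
  by_contra hyA
  obtain ⟨I, hI, hBI⟩ := (eq_top_or_exists_le_coatom
    (Submodule.comap (LinearMap.toSpanSingleton R R y) A)).resolve_left fun h => hyA (by
      have : (1 : R) ∈ Submodule.comap (LinearMap.toSpanSingleton R R y) A := by
        rw [h]; trivial
      simpa using this)
  obtain ⟨x, hx, hIx⟩ := hK I hI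
  obtain ⟨h, hh⟩ := hR.exists_comp_eq (Y := R)
    (A.subtype ∘ₗ LinearMap.fst R A R + LinearMap.toSpanSingleton R R y ∘ₗ LinearMap.snd R A R)
    (LinearMap.toSpanSingleton R R x ∘ₗ LinearMap.snd R A R) (by
      rintro ⟨a, r⟩ har
      have har' : (a : R) + r * y = 0 := har
      refine hIx r (hBI ?_)
      change r * y ∈ A
      rw [eq_neg_of_add_eq_zero_right har']
      exact A.neg_mem a.2)
  have hh' : ∀ r, h r = r * h 1 := fun r => by
    rw [← smul_eq_mul, ← map_smul, smul_eq_mul, mul_one]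
  refine hx ?_
  have h1 := hh (0, 1)
  simp only [LinearMap.add_apply, LinearMap.comp_apply, LinearMap.fst_apply,
    LinearMap.snd_apply, map_zero, zero_add,
    LinearMap.toSpanSingleton_apply, one_smul] at h1
  rw [← h1, hh']
  refine hy _ fun a ha => ?_
  have h2 := hh (⟨a, ha⟩, 0)
  simp only [LinearMap.add_apply, LinearMap.comp_apply, LinearMap.fst_apply,
    LinearMap.snd_apply, Submodule.subtype_apply, map_zero, add_zero] at h2
  rw [← hh', h2]

/-- A right Noetherian ring in which all one-sided ideals are annihilators is right
self-injective. -/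
theorem injective_right_of_lAnn_rAnn [IsNoetherian Rᵐᵒᵖ R]
    (hr : ∀ K : Submodule Rᵐᵒᵖ R, rAnn (lAnn (K : Set R) : Set R) = K)
    (hl : ∀ A : Ideal R, lAnn (rAnn (A : Set R) : Set R) = A) : Module.Injective Rᵐᵒᵖ R := by
  have key : ∀ K : Submodule Rᵐᵒᵖ R, K.FG → ∀ g : K →ₗ[Rᵐᵒᵖ] R,
      ∃ c : R, ∀ x : K, g x = c * x := by
    intro K hK
    induction K, hK using Submodule.fg_induction with
    | singleton x =>
      intro g
      set x' : Submodule.span Rᵐᵒᵖ {x} := ⟨x, Submodule.mem_span_singleton_self x⟩ with hx'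
      -- Whatever `x` kills on the right, `g x` kills too, so `g x` lies in the double annihilator
      -- of `Rx`.
      have hy : g x' ∈ lAnn (rAnn ((Ideal.span {x} : Ideal R) : Set R) : Set R) := by
        intro s hs
        have hxs : x * s = 0 := hs x (Ideal.mem_span_singleton_self x)
        have : MulOpposite.op s • x' = 0 := Subtype.ext hxs
        rw [← op_smul_eq_mul, ← map_smul, this, map_zero]
      rw [hl] at hy
      obtain ⟨c, hc⟩ := Ideal.mem_span_singleton'.1 hy
      refine ⟨c, fun z => ?_⟩
      obtain ⟨s, hs⟩ := Submodule.mem_span_singleton.1 z.2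
      have : z = s • x' := Subtype.ext hs.symm
      rw [this, map_smul, ← hc, ← MulOpposite.op_unop s]
      simp [hx', mul_assoc]
    | sup K L hK hL ihK ihL =>
      intro g
      obtain ⟨c, hc⟩ := ihK (g ∘ₗ Submodule.inclusion le_sup_left)
      obtain ⟨d, hd⟩ := ihL (g ∘ₗ Submodule.inclusion le_sup_right)
      -- The two multipliers agree on `K ⊓ L`, and the double annihilator conditions give `lAnn (K ⊓
      -- L) = lAnn K + lAnn L`. This permits correcting `c` and `d` to a common multiplier `c - k =
      -- d + l`.
      have hcd : c - d ∈ lAnn (K : Set R) ⊔ lAnn (L : Set R) := by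
        rw [← hl (lAnn (K : Set R) ⊔ lAnn (L : Set R)), rAnn_sup, hr, hr]
        rintro y ⟨hyK, hyL⟩
        rw [sub_mul, sub_eq_zero, ← hc ⟨y, hyK⟩, ← hd ⟨y, hyL⟩]
        rfl
      obtain ⟨k, hk, l, hl, hkl⟩ := Submodule.mem_sup.1 hcd
      refine ⟨c - k, fun z => ?_⟩
      obtain ⟨a, ha, b, hb, hab⟩ := Submodule.mem_sup.1 z.2
      have hz : z = Submodule.inclusion le_sup_left ⟨a, ha⟩ +
          Submodule.inclusion le_sup_right ⟨b, hb⟩ := Subtype.ext hab.symm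
      have h1 : g (Submodule.inclusion le_sup_left ⟨a, ha⟩) = c * a := hc ⟨a, ha⟩
      have h2 : g (Submodule.inclusion le_sup_right ⟨b, hb⟩) = d * b := hd ⟨b, hb⟩
      have h3 : c - k = d + l := by
        rw [sub_eq_iff_eq_add, add_assoc, add_comm l k, hkl]; abel
      rw [← hab]
      conv_lhs => rw [hz]
      rw [map_add, h1, h2, mul_add]
      congr 1
      · rw [sub_mul, hk a ha, sub_zero]
      · rw [h3, add_mul, hl b hb, add_zero]
  rw [injective_right_iff]
  refine Module.Baer.injective fun I g => ?_
  let φ := rightRegularEquiv R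
  obtain ⟨c, hc⟩ := key (Submodule.map φ.symm.toLinearMap I) (IsNoetherian.noetherian _)
    (φ.symm.toLinearMap ∘ₗ g ∘ₗ (φ.symm.submoduleMap I).symm.toLinearMap)
  refine ⟨LinearMap.toSpanSingleton Rᵐᵒᵖ Rᵐᵒᵖ (MulOpposite.op c), fun x hx => ?_⟩
  have := hc (φ.symm.submoduleMap I ⟨x, hx⟩)
  simp only [LinearMap.comp_apply, LinearEquiv.coe_coe, LinearEquiv.symm_apply_apply] at this
  exact (congrArg MulOpposite.op this).symm

/-- A left self-injective ring which is Noetherian on one side is right self-injective and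
semiprimary. -/
theorem injective_right_and_isSemiprimaryRing (hR : Module.Injective R R)
    (hN : IsNoetherianRing R ∨ IsNoetherianRing Rᵐᵒᵖ) :
    Module.Injective Rᵐᵒᵖ Rᵐᵒᵖ ∧ IsSemiprimaryRing R := by
  have : IsNoetherianRing Rᵐᵒᵖ := hN.elim (fun _ => isNoetherian_right_of_left hR) id
  have : IsNoetherian Rᵐᵒᵖ R := isNoetherian_right_iff.2 ‹_›
  refine ⟨injective_right_iff.1 (injective_right_of_lAnn_rAnn
    (fun K => rAnn_lAnn_of_fg hR (IsNoetherian.noetherian K))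
    (lAnn_rAnn hR fun I hI => exists_lAnn_ne hR hI)), ?_⟩
  exact ⟨isSemisimpleRing_quotient_jacobson_of_right hR, isNilpotent_jacobson_of_right hR⟩

end Kasch

/-! ### Symmetry of QF rings, injective hulls and the trace argument -/

section QuasiFrobenius

open DualKasch

variable {R : Type u} [Ring R]

attribute [local instance] RingHomInvPair.of_ringEquiv in
theorem injective_left_of_injective_op_op (h : Module.Injective Rᵐᵒᵖᵐᵒᵖ Rᵐᵒᵖᵐᵒᵖ) :
    Module.Injective R R :=
  Module.Injective.of_ringEquiv (RingEquiv.opOp R).symm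
    { toFun := fun x => x.unop.unop
      invFun := fun x => MulOpposite.op (MulOpposite.op x)
      map_add' := fun _ _ => rfl
      map_smul' := fun _ _ => rfl
      left_inv := fun _ => rfl
      right_inv := fun _ => rfl }

theorem DualKasch.IsOneSidedNoetherian.cases (h : IsOneSidedNoetherian R) :
    IsNoetherianRing R ∨ IsNoetherianRing Rᵐᵒᵖ :=
  h.imp id isNoetherian_right_iff.1

theorem DualKasch.IsQF.injective_left (h : IsQF R) : Module.Injective R R := by
  obtain ⟨hN, hl | hr⟩ := h
  · exact hl
  · refine injective_left_of_injective_op_op (injective_right_and_isSemiprimaryRing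
      (injective_right_iff.1 hr) (hN.cases.symm.imp id fun (_ : IsNoetherianRing R) => ?_)).1
    exact isNoetherianRing_of_ringEquiv R (RingEquiv.opOp R)

theorem DualKasch.IsQF.injective_right (h : IsQF R) : Module.Injective Rᵐᵒᵖ R :=
  injective_right_iff.2 (injective_right_and_isSemiprimaryRing h.injective_left h.1.cases).1

theorem DualKasch.IsQF.isSemiprimaryRing (h : IsQF R) : IsSemiprimaryRing R :=
  (injective_right_and_isSemiprimaryRing h.injective_left h.1.cases).2

theorem DualKasch.IsQF.isRightDualKasch (h : IsQF R) : IsRightDualKasch R := by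
  intro T _ _ hT
  have := IsSimpleModule.nontrivial Rᵐᵒᵖ T
  obtain ⟨t, ht⟩ := exists_ne (0 : T)
  refine ⟨R, inferInstance, inferInstance, rightMulMap t, h.injective_right, ?_⟩
  have hspan := IsSimpleModule.toSpanSingleton_surjective Rᵐᵒᵖ ht
  exact hspan.comp (rightRegularEquiv R).surjective

/-- A retraction of `ι` has kernel meeting the image of `ι` trivially, so by essentiality it is an
isomorphism `E ≅ R`. -/
theorem DualKasch.IsInjectiveHull.projective {E : Type u} [AddCommGroup E] [Module Rᵐᵒᵖ E]
    {ι : R →ₗ[Rᵐᵒᵖ] E} (hE : IsInjectiveHull ι) (hR : Module.Injective Rᵐᵒᵖ R) :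
    Module.Projective Rᵐᵒᵖ E := by
  obtain ⟨p, hp⟩ := hR.out ι hE.mono LinearMap.id
  have hker : LinearMap.ker p = ⊥ := by
    refine hE.essential _ ((Submodule.eq_bot_iff _).2 ?_)
    rintro _ ⟨hx, r, rfl⟩
    have : r = 0 := (hp r).symm.trans hx
    rw [this, map_zero]
  have := projective_right_regular (R := R)
  exact Module.Projective.of_equiv (LinearEquiv.ofBijective p
    ⟨LinearMap.ker_eq_bot.1 hker, fun r => ⟨ι r, hp r⟩⟩).symm

theorem DualKasch.IsMaxProjective.of_projective {M : Type u} [AddCommGroup M] [Module Rᵐᵒᵖ M]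
    [Module.Projective Rᵐᵒᵖ M] : IsMaxProjective R M := fun I _ f =>
  Module.projective_lifting_property I.mkQ f I.mkQ_surjective

/-- If the trace of an injective right module in `R` is all of `R`, then `R` is right
self-injective. -/
theorem injective_right_of_trace {E : Type u} [AddCommGroup E] [Module Rᵐᵒᵖ E]
    (hE : Module.Injective Rᵐᵒᵖ E)
    (h : ∀ I : Submodule Rᵐᵒᵖ R, IsCoatom I → ∃ (g : E →ₗ[Rᵐᵒᵖ] R) (x : E), g x ∉ I) :
    Module.Injective Rᵐᵒᵖ R := by
  classical
  have hco : IsCoatomic (Submodule Rᵐᵒᵖ R) :=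
    (Submodule.orderIsoMapComap (rightRegularEquiv R)).isCoatomic_iff.2 inferInstance
  have htop : ⨆ g : E →ₗ[Rᵐᵒᵖ] R, LinearMap.range g = ⊤ := by
    by_contra hne
    obtain ⟨I, hI, hle⟩ := (eq_top_or_exists_le_coatom _).resolve_left hne
    obtain ⟨g, x, hx⟩ := h I hI
    exact hx (hle (Submodule.mem_iSup_of_mem g ⟨x, rfl⟩))
  have h1 : (1 : R) ∈ ⨆ g : E →ₗ[Rᵐᵒᵖ] R, LinearMap.range g := by rw [htop]; trivial
  obtain ⟨s, hs⟩ := Submodule.mem_iSup_iff_exists_finset.1 h1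
  -- Since `1` lies in a finite sum of images, some `v` has `p v = 1`, and `r ↦ v r` splits `p`.
  let p : (s → E) →ₗ[Rᵐᵒᵖ] R := LinearMap.lsum Rᵐᵒᵖ (fun _ : s => E) ℕ fun g => g.1
  have hle : ⨆ g ∈ s, LinearMap.range g ≤ LinearMap.range p := by
    refine iSup₂_le fun g hg => ?_
    rintro _ ⟨x, rfl⟩
    exact ⟨Pi.single ⟨g, hg⟩ x,
      LinearMap.lsum_piSingle Rᵐᵒᵖ (fun _ : s => E) ℕ (fun g => g.1) ⟨g, hg⟩ x⟩
  obtain ⟨v, hv⟩ := hle hs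
  exact Module.Injective.of_retract (Q := s → E) inferInstance (rightMulMap v) p fun r => by
    rw [rightMulMap_apply, map_smul, hv]; simp

/-- The dual Kasch condition provides a map `E → R ⧸ I` sending `ι 1` to the class of `1`; its lift
`g : E → R` has `g (ι 1) ∉ I`. -/
theorem injective_right_of_isMaxProjective {E : Type u} [AddCommGroup E] [Module Rᵐᵒᵖ E]
    {ι : R →ₗ[Rᵐᵒᵖ] E} (hE : IsInjectiveHull ι) (hK : IsRightDualKasch R)
    (hM : IsMaxProjective R E) : Module.Injective Rᵐᵒᵖ R := by
  refine injective_right_of_trace hE.injective fun I hI => ?_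
  obtain ⟨Q, _, _, f, hQ, hf⟩ := hK (R ⧸ I) (isSimpleModule_iff_isCoatom.2 hI)
  obtain ⟨q, hq⟩ := hf (I.mkQ 1)
  obtain ⟨h, hh⟩ := hQ.out ι hE.mono (rightMulMap q)
  obtain ⟨g, hg⟩ := hM I hI (f ∘ₗ h)
  refine ⟨g, ι 1, fun hmem => hI.1 ?_⟩
  have h1 : I.mkQ (g (ι 1)) = I.mkQ 1 := by
    rw [← LinearMap.comp_apply, hg, LinearMap.comp_apply, hh, ← hq]; simp
  rw [Submodule.mkQ_apply, (Submodule.Quotient.mk_eq_zero I).2 hmem] at h1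
  have h2 : (1 : R) ∈ I := (Submodule.Quotient.mk_eq_zero I).1 h1.symm
  rw [eq_top_iff]
  intro r _
  simpa using I.smul_mem (MulOpposite.op r) h2

end QuasiFrobenius

/-! ### Commutative perfect rings: T-nilpotence and self-injectivity -/

section Commutative

open DualKasch

/-- Left T-nilpotence in inductive form: a property of ring elements that survives multiplication
by some element of `J` and holds at `1` also holds at `0`. -/
theorem prop_zero_of_tNilpotent {R : Type u} [Ring R] {J : Ideal R}
    (hT : ∀ a : ℕ → R, (∀ i, a i ∈ J) → ∃ n : ℕ, ((List.range n).map a).prod = 0)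
    (P : R → Prop) (h1 : P 1) (hstep : ∀ r, P r → ∃ a ∈ J, P (r * a)) : P 0 := by
  choose! g hgJ hgP using hstep
  let r : ℕ → {r : R // P r} := fun n => Nat.rec ⟨1, h1⟩ (fun _ r => ⟨r.1 * g r.1, hgP _ r.2⟩) n
  obtain ⟨n, hn⟩ := hT (fun i => g (r i).1) fun i => hgJ _ (r i).2
  have hprod : ∀ n, ((List.range n).map fun i => g (r i).1).prod = (r n).1 := by
    intro n
    induction n with
    | zero => rfl
    | succ n ih =>
      rw [List.range_succ, List.map_append, List.prod_append, ih]
      simp [r]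
  rw [hprod] at hn
  exact hn ▸ (r n).2

variable {R : Type u} [CommRing R]

/-- Nakayama's lemma for a T-nilpotent ideal. -/
theorem le_of_le_sup_smul_of_tNilpotent {J : Ideal R}
    (hT : ∀ a : ℕ → R, (∀ i, a i ∈ J) → ∃ n : ℕ, ((List.range n).map a).prod = 0)
    {M : Type u} [AddCommGroup M] [Module R M] {N F : Submodule R M} (h : N ≤ F ⊔ J • N) :
    N ≤ F := by
  by_contra hNF
  obtain ⟨x, hx, hxF⟩ := SetLike.not_le_iff_exists.1 hNF
  -- If `rN ⊄ F`, then `raN ⊄ F` for some `a ∈ J`, since otherwise `rN ⊆ rF + rJN ⊆ F`.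
  obtain ⟨y, -, hy⟩ := prop_zero_of_tNilpotent hT (fun r => ∃ x ∈ N, r • x ∉ F)
    ⟨x, hx, by rwa [one_smul]⟩ (by
      rintro r ⟨x, hx, hrx⟩
      by_contra! hcon
      have hle : J • N ≤ F.comap (LinearMap.lsmul R M r) := by
        refine Submodule.smul_le.2 fun a ha n hn => ?_
        change r • a • n ∈ F
        rw [smul_smul]
        exact hcon a ha n hn
      obtain ⟨f, hf, z, hz, rfl⟩ := Submodule.mem_sup.1 (h hx)
      refine hrx ?_
      rw [smul_add]
      exact F.add_mem (F.smul_mem r hf) (hle hz))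
  exact hy (by rw [zero_smul]; exact F.zero_mem)

theorem isNilpotent_of_tNilpotent {J : Ideal R}
    (hT : ∀ a : ℕ → R, (∀ i, a i ∈ J) → ∃ n : ℕ, ((List.range n).map a).prod = 0) {x : R}
    (hx : x ∈ J) : IsNilpotent x := by
  obtain ⟨n, hn⟩ := hT (fun _ => x) fun _ => hx
  exact ⟨n, by simpa using hn⟩

section

variable [IsSemisimpleRing (R ⧸ Ring.jacobson R)]
  (hT : ∀ a : ℕ → R, (∀ i, a i ∈ Ring.jacobson R) → ∃ n : ℕ, ((List.range n).map a).prod = 0)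
include hT

/-- T-nilpotence makes the radical nil, so idempotents lift modulo it. The element `b` from
semilocality is idempotent there because `(1 - b)b ∈ J`. The lift `e` cuts out the local factor of
`R` at `I`. -/
theorem exists_idempotent_of_isCoatom {I : Ideal R} (hI : IsCoatom I) :
    ∃ e : R, e * e = e ∧ 1 - e ∈ I ∧ e ∉ I ∧ ∀ x ∈ I, x * e ∈ Ring.jacobson R := by
  set J := Ring.jacobson R
  have hJI : J ≤ I := sInf_le hI
  obtain ⟨b, hb1, hbI, hb⟩ := exists_mul_mem_jacobson_of_isCoatom hI
  obtain ⟨e, he, heb⟩ := exists_isIdempotentElem_eq_of_ker_isNilpotent (Ideal.Quotient.mk J)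
    (fun x hx => isNilpotent_of_tNilpotent hT (by simpa [Ideal.Quotient.eq_zero_iff_mem] using hx))
    (Ideal.Quotient.mk J b) ⟨b, rfl⟩ (by
      rw [IsIdempotentElem, ← map_mul, eq_comm, Ideal.Quotient.eq]
      have := hb _ hb1
      rwa [sub_mul, one_mul] at this)
  rw [Ideal.Quotient.eq] at heb
  refine ⟨e, he, ?_, fun h => hbI ?_, fun x hx => ?_⟩
  · have := I.sub_mem hb1 (hJI heb)
    rwa [show 1 - b - (e - b) = 1 - e by ring] at this
  · have := I.sub_mem h (hJI heb)
    rwa [sub_sub_cancel] at this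
  · have := J.add_mem (hb x hx) (J.mul_mem_left x heb)
    rwa [show x * b + x * (e - b) = x * e by ring] at this

theorem exists_lAnn_ne_of_tNilpotent {I : Ideal R} (hI : IsCoatom I) :
    ∃ x : R, x ≠ 0 ∧ ∀ a ∈ I, a * x = 0 := by
  obtain ⟨e, he, -, heI, heJ⟩ := exists_idempotent_of_isCoatom hT hI
  by_contra! hcon
  -- If no nonzero element is killed by `I`, every `er ≠ 0` has `a ∈ I` with `aer ≠ 0`. The factor
  -- `ae` lies in the radical, so T-nilpotence is contradicted.
  refine prop_zero_of_tNilpotent hT (fun r => e * r ≠ 0) (fun h => heI ?_) (fun r hr => ?_)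
    (mul_zero e)
  · rw [mul_one] at h
    rw [h]; exact I.zero_mem
  · obtain ⟨a, ha, har⟩ := hcon _ hr
    refine ⟨a * e, heJ a ha, fun h => har ?_⟩
    calc a * (e * r) = a * (e * e * r) := by rw [he]
      _ = e * (r * (a * e)) := by ring
      _ = 0 := h

/-- For `P ≤ I` maximal and `x ∈ I`, the product `xe` is nilpotent, hence in `P`, while `e ∉ P`. -/
theorem isCoatom_of_isPrime {P : Ideal R} (hP : P.IsPrime) : IsCoatom P := by
  obtain ⟨I, hI, hPI⟩ := (eq_top_or_exists_le_coatom P).resolve_left hP.ne_top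
  obtain ⟨e, -, -, heI, heJ⟩ := exists_idempotent_of_isCoatom hT hI
  have hIP : I ≤ P := fun x hx => by
    obtain ⟨n, hn⟩ := isNilpotent_of_tNilpotent hT (heJ x hx)
    refine (hP.mem_or_mem (hP.mem_of_pow_mem n ?_)).resolve_right fun h => heI (hPI h)
    rw [hn]; exact P.zero_mem
  rwa [le_antisymm hPI hIP]

/-- A faithful right module over a commutative perfect ring is not equal to its product with a
maximal ideal. -/
theorem exists_notMem_of_faithful {E : Type u} [AddCommGroup E] [Module Rᵐᵒᵖ E]
    (hE : ∀ r : R, (∀ x : E, MulOpposite.op r • x = 0) → r = 0) {I : Ideal R} (hI : IsCoatom I)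
    (N : Submodule Rᵐᵒᵖ E) (hN : N = Submodule.span Rᵐᵒᵖ
      {y | ∃ a ∈ I, ∃ x : E, y = MulOpposite.op a • x}) : N ≠ ⊤ := by
  intro htop
  obtain ⟨e, he, -, heI, heJ⟩ := exists_idempotent_of_isCoatom hT hI
  -- If `re` does not kill `E = EI`, then some `rae` with `a ∈ I` does not kill `E`, and `ae` lies
  -- in the radical.
  obtain ⟨y, hy⟩ := prop_zero_of_tNilpotent hT (fun r => ∃ x : E, MulOpposite.op (r * e) • x ≠ 0)
    (by
      by_contra! hcon
      refine heI ?_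
      rw [hE e fun x => by simpa using hcon x]
      exact I.zero_mem) (by
      rintro r ⟨x, hx⟩
      by_contra! hcon
      have hle : N ≤ LinearMap.ker (LinearMap.lsmul Rᵐᵒᵖ E (MulOpposite.op (r * e))) := by
        rw [hN, Submodule.span_le]
        rintro _ ⟨a, ha, x, rfl⟩
        change MulOpposite.op (r * e) • MulOpposite.op a • x = 0
        rw [smul_smul, ← MulOpposite.op_mul, ← hcon (a * e) (heJ a ha) x]
        congr 2
        calc a * (r * e) = a * (r * (e * e)) := by rw [he]
          _ = r * (a * e) * e := by ring
      exact hx (hle (htop ▸ Submodule.mem_top)))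
  exact hy (by rw [zero_mul, MulOpposite.op_zero, zero_smul])

end

/-- A proper submodule containing the product of the module with a maximal ideal lies in a maximal
submodule. -/
theorem exists_isCoatom_of_smul_mem {m : Ideal R} [m.IsMaximal] {E : Type u} [AddCommGroup E]
    [Module R E] {N : Submodule R E} (hN : N ≠ ⊤) (hm : ∀ c ∈ m, ∀ x : E, c • x ∈ N) :
    ∃ L : Submodule R E, IsCoatom L ∧ N ≤ L := by
  -- The quotient `E ⧸ N` is a nonzero vector space over `R ⧸ m`, hence semisimple, so it has a
  -- maximal submodule.
  have htor : Module.IsTorsionBySet R (E ⧸ N) m :=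
    (Module.isTorsionBySet_quotient_iff N m).2 fun x c hc => hm c hc x
  let _ := htor.module
  let _ := Ideal.Quotient.field m
  have hss : IsSemisimpleModule R (E ⧸ N) :=
    (htor.semilinearMap.isSemisimpleModule_iff_of_bijective Function.bijective_id).2 inferInstance
  have : Nontrivial (E ⧸ N) := Submodule.Quotient.nontrivial_iff.2 hN
  obtain ⟨L, hL, -⟩ := (eq_top_or_exists_le_coatom (⊥ : Submodule R (E ⧸ N))).resolve_left
    bot_ne_top
  exact ⟨L.comap N.mkQ, (Submodule.isCoatom_comap_iff N.mkQ_surjective).2 hL, fun x hx => by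
    have : N.mkQ x = 0 := (Submodule.Quotient.mk_eq_zero N).2 hx
    rw [Submodule.mem_comap, this]; exact L.zero_mem⟩

/-- The hull contains `R`, so it is faithful and differs from its product with a maximal ideal `I'`.
It therefore has a quotient `R ⧸ I'`, and max-projectivity lifts this quotient map to a map `E → R`
with image not inside `I'`. -/
theorem injective_right_of_perfect_of_isMaxProjective [IsSemisimpleRing (R ⧸ Ring.jacobson R)]
    (hT : ∀ a : ℕ → R, (∀ i, a i ∈ Ring.jacobson R) → ∃ n : ℕ, ((List.range n).map a).prod = 0)
    {E : Type u} [AddCommGroup E] [Module Rᵐᵒᵖ E] {ι : R →ₗ[Rᵐᵒᵖ] E} (hE : IsInjectiveHull ι)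
    (hM : IsMaxProjective R E) : Module.Injective Rᵐᵒᵖ R := by
  refine injective_right_of_trace hE.injective fun I' hI' => ?_
  let I : Ideal R :=
    { carrier := I'
      add_mem' := I'.add_mem
      zero_mem' := I'.zero_mem
      smul_mem' := fun c x hx => by
        rw [smul_eq_mul, mul_comm]; exact I'.smul_mem (MulOpposite.op c) hx }
  let m : Ideal Rᵐᵒᵖ := Submodule.map (rightRegularEquiv R).toLinearMap I'
  have hm : IsCoatom m :=
    (OrderIso.isCoatom_iff (Submodule.orderIsoMapComap (rightRegularEquiv R)) I').2 hI'
  have hI : IsCoatom I := by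
    refine ⟨fun h => hI'.1 ?_, fun K hK => ?_⟩
    · rw [eq_top_iff]
      exact fun x _ => show x ∈ I by rw [h]; trivial
    · have := hI'.2 K.toRight hK
      rw [eq_top_iff]
      exact fun x _ => show x ∈ K.toRight by rw [this]; trivial
  have : m.IsMaximal := ⟨hm⟩
  have hne := exists_notMem_of_faithful (E := E) hT (fun r hr => hE.mono (by
    rw [map_zero, ← hr (ι 1), ← map_smul]; simp)) hI _ rfl
  obtain ⟨L, hL, hNL⟩ := exists_isCoatom_of_smul_mem (m := m) hne (by
    rintro _ ⟨a, ha, rfl⟩ x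
    exact Submodule.subset_span ⟨a, ha, x, rfl⟩)
  obtain ⟨x₀, hx₀⟩ : ∃ x, x ∉ L := by
    by_contra! h
    exact hL.1 (eq_top_iff.2 fun x _ => h x)
  let ρ : R →ₗ[Rᵐᵒᵖ] E ⧸ L := rightMulMap (L.mkQ x₀)
  have hx₀' : L.mkQ x₀ ≠ 0 := fun h => hx₀ ((Submodule.Quotient.mk_eq_zero L).1 h)
  have hsimple : IsSimpleModule Rᵐᵒᵖ (E ⧸ L) := isSimpleModule_iff_isCoatom.2 hL
  have hρ : Function.Surjective ρ :=
    (IsSimpleModule.toSpanSingleton_surjective Rᵐᵒᵖ hx₀').comp (rightRegularEquiv R).surjective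
  have hker : LinearMap.ker ρ = I' := by
    have hle : I' ≤ LinearMap.ker ρ := fun a ha => by
      have : MulOpposite.op a • x₀ ∈ L := hNL (Submodule.subset_span ⟨a, ha, x₀, rfl⟩)
      exact (Submodule.Quotient.mk_eq_zero L).2 this
    refine ((hI'.le_iff.1 hle).resolve_left fun h => hx₀' ?_)
    have : (1 : R) ∈ LinearMap.ker ρ := by rw [h]; trivial
    simpa [ρ] using this
  let φ := ρ.quotKerEquivOfSurjective hρ
  obtain ⟨g, hg⟩ := hM (LinearMap.ker ρ) (hker ▸ hI') (φ.symm.toLinearMap ∘ₗ L.mkQ)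
  refine ⟨g, x₀, fun h => hx₀' ?_⟩
  rw [← hker] at h
  have h1 : φ.symm (L.mkQ x₀) = 0 := by
    have := LinearMap.congr_fun hg x₀
    rw [LinearMap.comp_apply, Submodule.mkQ_apply, (Submodule.Quotient.mk_eq_zero _).2 h] at this
    exact this.symm
  simpa using h1

end Commutative

/-! ### Commutative perfect self-injective rings are Noetherian -/

section Commutative

open DualKasch

variable {R : Type u} [CommRing R]

/-- If `R` is self-injective, all ideals are annihilators and `R ⧸ I` embeds in `R`, then `I ⧸ I²`
is finite-dimensional over `R ⧸ I`. -/
theorem exists_fg_le_sup_mul (hR : Module.Injective R R)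
    (hl : ∀ A : Ideal R, lAnn (rAnn (A : Set R) : Set R) = A) {I : Ideal R} (hI : I.IsMaximal)
    {u : R} (hu : u ≠ 0) (hIu : ∀ a ∈ I, a * u = 0) :
    ∃ F : Ideal R, F.FG ∧ F ≤ I ∧ I ≤ F ⊔ I * I := by
  let _ := Ideal.Quotient.field I
  let μ : R ⧸ I →ₗ[R] R := I.liftQ (LinearMap.toSpanSingleton R R u) hIu
  have hμ1 : μ 1 = u := one_smul R u
  have hμ : ∀ x, μ x = 0 → x = 0 := by
    intro x hx
    obtain ⟨r, rfl⟩ := Ideal.Quotient.mk_surjective x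
    rw [Ideal.Quotient.eq_zero_iff_mem]
    by_contra hr
    obtain ⟨s, i, hi, hs⟩ := hI.exists_inv hr
    refine hu ?_
    have hru : r * u = 0 := hx
    calc u = (s * r + i) * u := by rw [hs, one_mul]
      _ = s * (r * u) + i * u := by ring
      _ = 0 := by rw [hru, hIu i hi]; simp
  -- functionals on the cotangent space are multiplications by elements of `R`
  have hmul : ∀ φ : I.Cotangent →ₗ[R ⧸ I] (R ⧸ I), ∃ c : R, ∀ x : I,
      c * x = μ (φ (I.toCotangent x)) := by
    intro φ
    obtain ⟨f, hf⟩ := hR.out I.subtype I.injective_subtype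
      (μ ∘ₗ φ.restrictScalars R ∘ₗ I.toCotangent)
    refine ⟨f 1, fun x => ?_⟩
    rw [mul_comm, ← smul_eq_mul, ← map_smul, smul_eq_mul, mul_one]
    exact hf x
  let b := Module.Basis.ofVectorSpace (R ⧸ I) I.Cotangent
  choose β hβ using fun i => I.toCotangent_surjective (b i)
  choose c hc using fun i => hmul (b.coord i)
  -- The functional equal to `1` on every basis vector gives `d` with `d * β i = u ≠ 0` for all `i`.
  obtain ⟨d, hd⟩ := hmul (b.constr ℕ fun _ => (1 : R ⧸ I))
  let D : Ideal R :=
    { carrier := {r | {i | r * β i ≠ 0}.Finite}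
      add_mem' := fun {r s} hr hs => (hr.union hs).subset fun i hi => by
        by_contra hcon
        simp only [Set.mem_union, Set.mem_ofPred_eq, not_or, not_not] at hcon
        exact hi (by rw [add_mul, hcon.1, hcon.2, add_zero])
      zero_mem' := by simp
      smul_mem' := fun t r hr => hr.subset fun i hi h => hi (by
        rw [smul_eq_mul, mul_assoc, h, mul_zero]) }
  have hcD : ∀ i, c i ∈ D := by
    intro i
    refine (Set.finite_singleton i).subset fun j hj => ?_
    by_contra hij
    refine hj ?_
    rw [hc, hβ, Module.Basis.coord_apply, b.repr_self, Finsupp.single_eq_of_ne (Ne.symm hij),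
      map_zero]
  -- If `D` kills `y`, then so does the annihilator of `I`, which lies in `D`, and `y ∈ I`. All `c
  -- i` kill `y`, so the coordinates of its class in `I ⧸ I²` vanish and `dy = 0`. Thus `d` is in
  -- the double annihilator of `D`, which is `D`, and this forces the basis to be finite.
  have hdD : d ∈ D := by
    rw [← hl D]
    intro y hy
    have hyI : y ∈ I := by
      rw [← hl I]
      intro r hr
      rw [mul_comm]
      refine hy r ?_
      have : {i | r * (β i : R) ≠ 0} = ∅ := by
        ext i
        simpa [mul_comm] using hr (β i) (β i).2
      change {i | r * (β i : R) ≠ 0}.Finite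
      rw [this]; exact Set.finite_empty
    have hy0 : I.toCotangent ⟨y, hyI⟩ = 0 := by
      refine b.ext_elem fun i => ?_
      rw [map_zero, Finsupp.zero_apply, ← Module.Basis.coord_apply]
      exact hμ _ ((hc i ⟨y, hyI⟩).symm.trans (hy _ (hcD i)))
    rw [hd ⟨y, hyI⟩, hy0, map_zero, map_zero]
  have hfin : Finite (Module.Basis.ofVectorSpaceIndex (R ⧸ I) I.Cotangent) := by
    have hall : {i | d * (β i : R) ≠ 0} = Set.univ := by
      ext i
      simp only [Set.mem_ofPred_eq, Set.mem_univ, iff_true]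
      rw [hd, hβ, Module.Basis.constr_basis, hμ1]
      exact hu
    exact Set.finite_univ_iff.1 (hall ▸ hdD)
  have hspan : (Submodule.span R (Set.range β)).map I.toCotangent = ⊤ := by
    rw [Submodule.map_span, ← Set.range_comp, show I.toCotangent ∘ β = b from funext hβ,
      ← Submodule.restrictScalars_span R (R ⧸ I) Ideal.Quotient.mk_surjective, b.span_eq]
    rfl
  refine ⟨(Submodule.span R (Set.range β)).map I.subtype,
    (Submodule.fg_span (Set.finite_range β)).map _, Submodule.map_subtype_le _ _, fun x hx => ?_⟩
  obtain ⟨y, hy, hyx⟩ : I.toCotangent ⟨x, hx⟩ ∈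
    (Submodule.span R (Set.range β)).map I.toCotangent := by rw [hspan]; trivial
  have h1 := I.toCotangent_eq.1 hyx.symm
  rw [pow_two] at h1
  exact Submodule.mem_sup.2 ⟨y, ⟨y, hy, rfl⟩, x - y, h1, by simp⟩

/-- By Cohen's theorem it suffices to treat a prime `I`, which is maximal. From `I ≤ F + I²`,
splitting `z ∈ I²` as `z(1 - e) + ze` with `ze ∈ JI` gives `I ≤ F + R(1 - e) + JI`, and Nakayama
removes `JI`. -/
theorem isNoetherianRing_of_perfect_of_injective [IsSemisimpleRing (R ⧸ Ring.jacobson R)]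
    (hT : ∀ a : ℕ → R, (∀ i, a i ∈ Ring.jacobson R) → ∃ n : ℕ, ((List.range n).map a).prod = 0)
    (hR : Module.Injective R R) : IsNoetherianRing R := by
  refine IsNoetherianRing.of_prime fun I hP => ?_
  have hI : IsCoatom I := isCoatom_of_isPrime hT hP
  obtain ⟨u, hu, hIu⟩ := exists_lAnn_ne_of_tNilpotent hT hI
  obtain ⟨F, hF, hFI, hIF⟩ := exists_fg_le_sup_mul hR
    (lAnn_rAnn hR fun I hI => exists_lAnn_ne_of_tNilpotent hT hI) ⟨hI⟩ hu hIu
  obtain ⟨e, -, heI, -, heJ⟩ := exists_idempotent_of_isCoatom hT hI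
  have hle : F ⊔ Ideal.span {1 - e} ≤ I :=
    sup_le hFI ((Ideal.span_singleton_le_iff_mem I).2 heI)
  have hge : I ≤ F ⊔ Ideal.span {1 - e} := by
    refine le_of_le_sup_smul_of_tNilpotent hT fun x hx => ?_
    have hII : ∀ z ∈ I * I, z * e ∈ Ring.jacobson R • I := fun z hz => by
      refine Submodule.mul_induction_on hz (fun a ha b hb => ?_) fun a b ha hb => ?_
      · rw [show a * b * e = (a * e) • b by rw [smul_eq_mul]; ring]
        exact Submodule.smul_mem_smul (heJ a ha) hb
      · rw [add_mul]; exact Submodule.add_mem _ ha hb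
    obtain ⟨f, hf, z, hz, rfl⟩ := Submodule.mem_sup.1 (hIF hx)
    refine Submodule.mem_sup.2 ⟨f + z * (1 - e), Submodule.add_mem _ (Submodule.mem_sup_left hf)
      (Submodule.mem_sup_right ?_), z * e, hII z hz, by ring⟩
    exact Ideal.mul_mem_left _ z (Ideal.mem_span_singleton_self _)
  rw [le_antisymm hge hle]
  exact Submodule.FG.sup hF ⟨{1 - e}, by simp⟩

end Commutative

/-! ### Semiprimary rings are perfect; assembling the equivalences -/

section Perfect

open DualKasch

variable {R : Type u} [Ring R]

theorem list_prod_mem_pow {J : Ideal R} [J.IsTwoSided] (l : List R) (h : ∀ a ∈ l, a ∈ J) :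
    l.prod ∈ J ^ l.length := by
  induction l with
  | nil => simp [Submodule.pow_zero, Ideal.one_eq_top]
  | cons a l ih =>
    rw [List.prod_cons, List.length_cons, Ideal.IsTwoSided.pow_succ]
    exact Ideal.mul_mem_mul (h a (by simp)) (ih fun b hb => h b (by simp [hb]))

theorem DualKasch.IsPerfect.of_isSemiprimaryRing [h : IsSemiprimaryRing R] : IsPerfect R := by
  obtain ⟨n, hn⟩ := h.isNilpotent
  have hzero : ∀ l : List R, l.length = n → (∀ a ∈ l, a ∈ Ring.jacobson R) → l.prod = 0 := by
    intro l hl hlJ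
    have := list_prod_mem_pow l hlJ
    rw [hl, hn] at this
    exact this
  refine ⟨⟨h.isSemisimpleRing, fun a ha => ⟨n, hzero _ (by simp) ?_⟩⟩,
    ⟨h.isSemisimpleRing, fun a ha => ⟨n, hzero _ (by simp) ?_⟩⟩⟩ <;>
  · intro x hx
    obtain ⟨i, -, rfl⟩ : ∃ i, i < n ∧ a i = x := by simpa using hx
    exact ha i

attribute [local instance] RingHomInvPair.of_ringEquiv in
theorem DualKasch.IsQF.of_isPerfect (hcomm : ∀ a b : R, a * b = b * a) {E : Type u}
    [AddCommGroup E] [Module Rᵐᵒᵖ E] {ι : R →ₗ[Rᵐᵒᵖ] E} (hE : IsInjectiveHull ι)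
    (hP : IsPerfect R) (hM : IsMaxProjective R E) : IsQF R := by
  -- The commutative structure extends the given ring structure, so the hypotheses on `R` and `E`
  -- transfer unchanged.
  let _ : CommRing R := { ‹Ring R› with mul_comm := hcomm }
  obtain ⟨⟨hss, hT⟩, -⟩ := hP
  have hss' : IsSemisimpleRing (R ⧸ Ring.jacobson R) := hss
  have hr : Module.Injective Rᵐᵒᵖ R := injective_right_of_perfect_of_isMaxProjective hT hE hM
  have hl : Module.Injective R R := by
    have := injective_right_iff.1 hr
    exact Module.Injective.of_ringEquiv (RingEquiv.toOpposite R).symm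
      { toFun := MulOpposite.unop
        invFun := MulOpposite.op
        map_add' := fun _ _ => rfl
        map_smul' := fun a b => hcomm _ _
        left_inv := fun _ => rfl
        right_inv := fun _ => rfl }
  exact ⟨.inl (isNoetherianRing_of_perfect_of_injective hT hl), .inr hr⟩

end Perfect

/-- `E` is an arbitrary injective hull of the right module `R_R`, with embedding `ι`. -/
theorem mainTheorem10 (R : Type u) [Ring R] [Nontrivial R]
    (E : Type u) [AddCommGroup E] [Module Rᵐᵒᵖ E]
    (ι : R →ₗ[Rᵐᵒᵖ] E) (hE : DualKasch.IsInjectiveHull ι) :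
    List.TFAE
      [DualKasch.IsQF R,
       DualKasch.IsOneSidedNoetherian R ∧ DualKasch.IsRightDualKasch R ∧
         Module.Projective Rᵐᵒᵖ E,
       DualKasch.IsOneSidedNoetherian R ∧ DualKasch.IsRightDualKasch R ∧
         DualKasch.IsSemilocal R ∧ DualKasch.IsMaxProjective R E] ∧
    ((∀ a b : R, a * b = b * a) →
      List.TFAE
        [DualKasch.IsQF R,
         DualKasch.IsOneSidedNoetherian R ∧ DualKasch.IsRightDualKasch R ∧
           Module.Projective Rᵐᵒᵖ E,
         DualKasch.IsOneSidedNoetherian R ∧ DualKasch.IsRightDualKasch R ∧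
           DualKasch.IsSemilocal R ∧ DualKasch.IsMaxProjective R E,
         DualKasch.IsPerfect R ∧ DualKasch.IsMaxProjective R E]) := by
  have h12 : DualKasch.IsQF R → DualKasch.IsOneSidedNoetherian R ∧
      DualKasch.IsRightDualKasch R ∧ Module.Projective Rᵐᵒᵖ E := fun h =>
    ⟨h.1, h.isRightDualKasch, hE.projective h.injective_right⟩
  have h13 : DualKasch.IsQF R → DualKasch.IsOneSidedNoetherian R ∧
      DualKasch.IsRightDualKasch R ∧ DualKasch.IsSemilocal R ∧
        DualKasch.IsMaxProjective R E := fun h =>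
    have := hE.projective h.injective_right
    ⟨h.1, h.isRightDualKasch, h.isSemiprimaryRing.isSemisimpleRing, .of_projective⟩
  have h21 : (DualKasch.IsOneSidedNoetherian R ∧ DualKasch.IsRightDualKasch R ∧
      Module.Projective Rᵐᵒᵖ E) → DualKasch.IsQF R := fun ⟨hN, hK, _⟩ =>
    ⟨hN, .inr (injective_right_of_isMaxProjective hE hK .of_projective)⟩
  have h31 : (DualKasch.IsOneSidedNoetherian R ∧ DualKasch.IsRightDualKasch R ∧
      DualKasch.IsSemilocal R ∧ DualKasch.IsMaxProjective R E) → DualKasch.IsQF R :=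
    fun ⟨hN, hK, _, hM⟩ => ⟨hN, .inr (injective_right_of_isMaxProjective hE hK hM)⟩
  refine ⟨?_, fun hcomm => ?_⟩
  · tfae_have 1 → 2 := h12
    tfae_have 1 → 3 := h13
    tfae_have 2 → 1 := h21
    tfae_have 3 → 1 := h31
    tfae_finish
  · tfae_have 1 → 2 := h12
    tfae_have 1 → 3 := h13
    tfae_have 2 → 1 := h21
    tfae_have 3 → 1 := h31
    tfae_have 1 → 4 := fun h =>
      have := h.isSemiprimaryRing
      have := hE.projective h.injective_right
      ⟨.of_isSemiprimaryRing, .of_projective⟩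
    tfae_have 4 → 1 := fun ⟨hP, hM⟩ => .of_isPerfect hcomm hE hP hM
    tfae_finish
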